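/- Let $F$ denote the Gauss hypergeometric function $F(\tfrac12,\tfrac12;1;\cdot)$, that is, the sum of the series $\sum_{n\ge 0}\frac{(1/2)_n(1/2)_n}{(n!)^2}z^n$ for $|z|<1$, continued holomorphically to $\mathbb{C}\setminus[1,+\infty)$ by Euler's integral $$F(z)=\frac1\pi\int_0^1\frac{dt}{\sqrt{t(1-t)(1-tz)}},$$ where $\sqrt{1-tz}$ is the principal branch. Put $\Lambda:=(0,1)\cup(\mathbb{C}\setminus\mathbb{R})$ and define the Schwarz triangle function by $$\tau(z):=i\,\frac{F(1-z)}{F(z)},\qquad z\in\Lambda.$$ Then $\tau(\Lambda)$ is exactly the fundamental quadrilateral $$\{z\in\mathbb{C} : \operatorname{Im} z>0,\ -1<\operatorname{Re} z<1,\ |2z-1|>1,\ |2z+1|>1\},$$ and $\tau$ is one-to-one on $\Lambda$. -/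

import Mathlib

open Set Complex

/-- The Gauss hypergeometric function `F(a, b; c; z)` on `ℂ \ [1, +∞)`, given for
`0 < Re b < Re c` by Euler's integral
`Γ(c) / (Γ(b) Γ(c - b)) ∫₀¹ t^(b-1) (1-t)^(c-b-1) (1 - t z)^(-a) dt` (principal branches).
It is the holomorphic continuation of the Gauss series: see `gaussHG_eq_ordinaryHypergeometric`
and `differentiableOn_gaussHG`. -/
noncomputable def gaussHG (a b c z : ℂ) : ℂ :=
  Gamma c / (Gamma b * Gamma (c - b)) *
    ∫ t : ℝ in (0 : ℝ)..1,
      (t : ℂ) ^ (b - 1) * (1 - (t : ℂ)) ^ (c - b - 1) * (1 - (t : ℂ) * z) ^ (-a)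

/-- On the unit disc, `gaussHG` is the sum of the Gauss hypergeometric series. -/
theorem gaussHG_eq_ordinaryHypergeometric {a b c z : ℂ} (hb : 0 < b.re) (hbc : b.re < c.re)
    (hz : ‖z‖ < 1) : gaussHG a b c z = ordinaryHypergeometric a b c z := by
  have hcb : 0 < (c - b).re := by simpa using hbc
  have hc : 0 < c.re := hb.trans hbc
  set w : ℝ → ℂ := fun t => (t : ℂ) ^ (b - 1) * (1 - (t : ℂ)) ^ (c - b - 1) with hw
  have hwint : IntervalIntegrable w MeasureTheory.volume 0 1 := betaIntegral_convergent hb hcb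
  -- binomial series
  have hser : ∀ y : ℂ, ‖y‖ < 1 →
      HasSum (fun n : ℕ => Ring.choose (a + n - 1) n * y ^ n) ((1 - y) ^ (-a)) := by
    intro y hy
    have h := (one_div_one_sub_cpow_hasFPowerSeriesOnBall_zero a).hasSum (y := y)
      (by rw [mem_eball_zero_iff, ← ofReal_norm, ENNReal.ofReal_lt_one]; exact hy)
    simpa [FormalMultilinearSeries.ofScalars_apply_eq, cpow_neg, mul_comm] using h
  have hsum : Summable (fun n : ℕ => ‖Ring.choose (a + n - 1) n * z ^ n‖) :=
    (hser z hz).summable.norm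
  have hle : ∀ t ∈ Set.uIoc (0 : ℝ) 1, 0 < t ∧ t ≤ 1 := by
    intro t ht
    rwa [Set.uIoc_of_le zero_le_one] at ht
  have key := intervalIntegral.hasSum_integral_of_dominated_convergence
    (μ := MeasureTheory.volume) (a := 0) (b := 1)
    (F := fun (n : ℕ) (t : ℝ) => w t * (Ring.choose (a + n - 1) n * ((t : ℂ) * z) ^ n))
    (f := fun t => w t * (1 - (t : ℂ) * z) ^ (-a))
    (fun n t => ‖w t‖ * ‖Ring.choose (a + n - 1) n * z ^ n‖)
    (fun n => by
      refine MeasureTheory.AEStronglyMeasurable.mul ?_ ?_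
      · exact hwint.def'.aestronglyMeasurable
      · exact Continuous.aestronglyMeasurable (by fun_prop))
    (fun n => Filter.Eventually.of_forall fun t ht => by
      obtain ⟨h0, h1⟩ := hle t ht
      rw [norm_mul (w t), norm_mul _ (_ ^ n), norm_mul _ (z ^ n), norm_pow, norm_pow, norm_mul _ z]
      gcongr
      rw [norm_real, Real.norm_of_nonneg h0.le]
      exact mul_le_of_le_one_left (norm_nonneg _) h1)
    (Filter.Eventually.of_forall fun t _ => hsum.mul_left _)
    (by
      simp_rw [tsum_mul_left]
      exact hwint.norm.mul_const _)
    (Filter.Eventually.of_forall fun t ht => by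
      obtain ⟨h0, h1⟩ := hle t ht
      refine (hser _ ?_).mul_left _
      rw [norm_mul, norm_real, Real.norm_of_nonneg h0.le]
      exact (mul_le_of_le_one_left (norm_nonneg _) h1).trans_lt hz)
  have hint : ∀ n : ℕ, ∫ t : ℝ in (0 : ℝ)..1,
      w t * (Ring.choose (a + n - 1) n * ((t : ℂ) * z) ^ n) =
        Ring.choose (a + n - 1) n * z ^ n * betaIntegral (b + n) (c - b) := by
    intro n
    rw [betaIntegral, ← intervalIntegral.integral_const_mul]
    refine intervalIntegral.integral_congr_ae (Filter.Eventually.of_forall fun t ht => ?_)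
    obtain ⟨h0, h1⟩ := hle t ht
    have h0' : (t : ℂ) ≠ 0 := ofReal_ne_zero.mpr h0.ne'
    have : (t : ℂ) ^ (b + n - 1) = (t : ℂ) ^ (b - 1) * (t : ℂ) ^ n := by
      rw [← cpow_natCast, ← cpow_add _ _ h0']
      congr 1; ring
    simp only [hw, this, mul_pow]
    ring
  rw [gaussHG, ordinaryHypergeometric_eq_tsum]
  simp only
  rw [← key.tsum_eq, ← tsum_mul_left]
  refine tsum_congr fun n => ?_
  rw [hint n, smul_eq_mul]
  have hΓb : Gamma b ≠ 0 := Gamma_ne_zero_of_re_pos hb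
  have hΓc : Gamma c ≠ 0 := Gamma_ne_zero_of_re_pos hc
  have hΓcb : Gamma (c - b) ≠ 0 := Gamma_ne_zero_of_re_pos hcb
  have hbn : 0 < (b + n).re := by simp; positivity
  have hcn : 0 < (c + n).re := by simp; positivity
  have hΓcn : Gamma (c + n) ≠ 0 := Gamma_ne_zero_of_re_pos hcn
  have hbeta := Gamma_mul_Gamma_eq_betaIntegral hbn hcb
  rw [show b + n + (c - b) = c + n by ring] at hbeta
  have hnot : ∀ x : ℂ, 0 < x.re → ∀ m : ℕ, x ≠ -m := by
    intro x hx m h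
    rw [h] at hx
    simp at hx
    linarith [Nat.cast_nonneg (α := ℝ) m]
  have hpb : (ascPochhammer ℂ n).eval b = Gamma (b + n) / Gamma b := by
    rw [Gamma_add_nat_div_Gamma_eq]
    exact hnot b hb
  have hpc : (ascPochhammer ℂ n).eval c = Gamma (c + n) / Gamma c := by
    rw [Gamma_add_nat_div_Gamma_eq]
    exact hnot c hc
  have hch : Ring.choose (a + n - 1) n = (n.factorial : ℂ)⁻¹ * (ascPochhammer ℂ n).eval a := by
    have h := Ring.factorial_nsmul_multichoose_eq_ascPochhammer a n
    rw [Polynomial.ascPochhammer_smeval_eq_eval] at h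
    rw [Ring.choose, ← h, show a + n - 1 - n + 1 = a by ring, nsmul_eq_mul,
      inv_mul_cancel_left₀ (by exact_mod_cast n.factorial_ne_zero)]
  have hbeta' : betaIntegral (b + n) (c - b) = Gamma (b + n) * Gamma (c - b) / Gamma (c + n) := by
    rw [hbeta]; field_simp
  rw [hch, hpb, hpc, hbeta']
  field_simp

/-- `gaussHG` is holomorphic on `ℂ \ [1, +∞)`. -/
theorem differentiableOn_gaussHG {a b c : ℂ} (hb : 0 < b.re) (hbc : b.re < c.re) :
    DifferentiableOn ℂ (gaussHG a b c) {z : ℂ | z.re < 1 ∨ z.im ≠ 0} := by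
  have hcb : 0 < (c - b).re := by simpa using hbc
  set w : ℝ → ℂ := fun t => (t : ℂ) ^ (b - 1) * (1 - (t : ℂ)) ^ (c - b - 1) with hw
  have hwint : IntervalIntegrable w MeasureTheory.volume 0 1 := betaIntegral_convergent hb hcb
  have hopen : IsOpen {z : ℂ | z.re < 1 ∨ z.im ≠ 0} :=
    (isOpen_lt continuous_re continuous_const).union
      (isOpen_ne_fun continuous_im continuous_const)
  have hslit : ∀ z : ℂ, (z.re < 1 ∨ z.im ≠ 0) → ∀ t ∈ Icc (0 : ℝ) 1,
      1 - (t : ℂ) * z ∈ slitPlane := by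
    rintro z hz t ⟨h0, h1⟩
    rw [mem_slitPlane_iff]
    simp only [sub_re, one_re, mul_re, ofReal_re, ofReal_im, zero_mul, sub_zero, sub_im, one_im,
      mul_im, add_zero, zero_sub, neg_ne_zero, sub_pos, mul_ne_zero_iff]
    rcases h0.eq_or_lt with rfl | h0
    · left; simp
    · rcases hz with hz | hz
      · left; nlinarith
      · right; exact ⟨h0.ne', hz⟩
  have hle : ∀ t ∈ Set.uIoc (0 : ℝ) 1, t ∈ Icc (0 : ℝ) 1 := by
    intro t ht
    rw [Set.uIoc_of_le zero_le_one] at ht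
    exact Ioc_subset_Icc_self ht
  intro z₀ hz₀
  obtain ⟨r, hr, hball⟩ := Metric.isOpen_iff.mp hopen z₀ hz₀
  have hr2 : Metric.closedBall z₀ (r / 2) ⊆ {z : ℂ | z.re < 1 ∨ z.im ≠ 0} :=
    (Metric.closedBall_subset_ball (half_lt_self hr)).trans hball
  have hcont : ∀ e : ℂ, ContinuousOn (fun p : ℂ × ℝ => (1 - (p.2 : ℂ) * p.1) ^ e)
      (Metric.closedBall z₀ (r / 2) ×ˢ Icc (0 : ℝ) 1) := by
    intro e
    refine ContinuousOn.cpow_const (by fun_prop) ?_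
    rintro ⟨z, t⟩ ⟨hz, ht⟩
    exact hslit z (hr2 hz) t ht
  have hcontt : ∀ e : ℂ, ∀ z ∈ Metric.closedBall z₀ (r / 2),
      ContinuousOn (fun t : ℝ => (1 - (t : ℂ) * z) ^ e) (Set.uIcc (0 : ℝ) 1) := by
    intro e z hz
    rw [Set.uIcc_of_le zero_le_one]
    refine ContinuousOn.cpow_const (by fun_prop) ?_
    intro t ht
    exact hslit z (hr2 hz) t ht
  have hz₀m : z₀ ∈ Metric.closedBall z₀ (r / 2) := Metric.mem_closedBall_self (by positivity)
  have hI : ∀ e : ℂ, ∀ z ∈ Metric.closedBall z₀ (r / 2), IntervalIntegrable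
      (fun t : ℝ => w t * (1 - (t : ℂ) * z) ^ e) MeasureTheory.volume 0 1 :=
    fun e z hz => hwint.mul_continuousOn (hcontt e z hz)
  obtain ⟨C, hC⟩ := ((isCompact_closedBall z₀ (r / 2)).prod isCompact_Icc).exists_bound_of_continuousOn
    ((hcont (-a - 1)).const_smul a |>.mul
      (show ContinuousOn (fun p : ℂ × ℝ => (p.2 : ℂ)) _ by fun_prop))
  have hmem : Metric.closedBall z₀ (r / 2) ∈ nhds z₀ := Metric.closedBall_mem_nhds _ (by positivity)
  have key := intervalIntegral.hasDerivAt_integral_of_dominated_loc_of_deriv_le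
    (μ := MeasureTheory.volume) (a := 0) (b := 1) (x₀ := z₀)
    (F := fun z (t : ℝ) => w t * (1 - (t : ℂ) * z) ^ (-a))
    (F' := fun z (t : ℝ) => w t * (a * (1 - (t : ℂ) * z) ^ (-a - 1) * t))
    (bound := fun t => ‖w t‖ * C) hmem
    (Filter.mem_of_superset hmem fun z hz => (hI (-a) z hz).def'.aestronglyMeasurable)
    (hI (-a) z₀ hz₀m)
    (by
      have : IntervalIntegrable (fun t : ℝ => w t * (a * (1 - (t : ℂ) * z₀) ^ (-a - 1) * t))
          MeasureTheory.volume 0 1 :=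
        hwint.mul_continuousOn
          ((continuousOn_const.mul (hcontt (-a - 1) z₀ hz₀m)).mul (by fun_prop))
      exact this.def'.aestronglyMeasurable)
    (Filter.Eventually.of_forall fun t ht z hz => by
      rw [norm_mul]
      gcongr
      exact hC (z, t) ⟨hz, hle t ht⟩)
    (hwint.norm.mul_const _)
    (Filter.Eventually.of_forall fun t ht z hz => by
      refine HasDerivAt.const_mul (w t) ?_
      have h1 : HasDerivAt (fun z : ℂ => 1 - (t : ℂ) * z) (-(t : ℂ)) z := by
        simpa using ((hasDerivAt_id z).const_mul (t : ℂ)).const_sub 1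
      have h2 := h1.cpow_const (c := -a) (hslit z (hr2 hz) t (hle t ht))
      rw [show a * (1 - (t : ℂ) * z) ^ (-a - 1) * t = -a * (1 - (t : ℂ) * z) ^ (-a - 1) * -(t : ℂ) by
        ring]
      exact h2)
  exact (key.2.differentiableAt.const_mul _).differentiableWithinAt

/-- The function `F = F(1/2, 1/2; 1; ·)`. -/
noncomputable def hypF (z : ℂ) : ℂ := gaussHG (1 / 2) (1 / 2) 1 z

/-- The set `(0, 1) ∪ (ℂ \ ℝ)`. -/
def slitDomain : Set ℂ := ((fun x : ℝ => (x : ℂ)) '' Ioo 0 1) ∪ {z : ℂ | z.im ≠ 0}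

/-- The Schwarz triangle function `z ↦ i F(1 - z) / F(z)`. -/
noncomputable def schwarzTriangle (z : ℂ) : ℂ := I * (hypF (1 - z) / hypF z)

/-- The fundamental quadrilateral
`{z : Im z > 0, -1 < Re z < 1, |2z - 1| > 1, |2z + 1| > 1}`. -/
def fundamentalQuadrilateral : Set ℂ :=
  {z : ℂ | 0 < z.im ∧ -1 < z.re ∧ z.re < 1 ∧ 1 < ‖2 * z - 1‖ ∧ 1 < ‖2 * z + 1‖}

/-! Write `F` for `hypF` and `τ` for `schwarzTriangle`. The argument shows that `τ` is a proper
local homeomorphism from the slit domain into the quadrilateral `Q`, and that the value `i` is taken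
exactly once; connectedness of `Q` does the rest.

Signs: in Euler's integral `(1 - tz)^(-1/2)` has positive real part, and its imaginary part has the
sign of `Im z`. Hence `F` has no zero on the cut plane, and `Re τ` has the sign of `Im z` off the
real axis.

Symmetries: `τ(1 - z) = -1/τ(z)` is immediate. For `Im z > 0`, `τ(z/(z-1)) = τ(z) - 1` combines
Pfaff's transformation (`hypF_pfaff`) with the connection formula (`hypF_connection`). The latter is
an identity between solutions of the hypergeometric equation, checked at the fixed point `exp(iπ/3)`
of `z ↦ 1/(1-z)`.

Image in `Q`: since `z/(z-1)` exchanges the half-planes, the signs and the translation give `|Re τ|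
< 1`, and the inversion gives `|Re (1/τ)| < 1`, which is the pair of circle conditions. These
exclude real values, so `Im τ > 0` follows from `τ(1/2) = i` by connectedness.

Bijection: the Wronskian makes `τ' ≠ 0`. The logarithmic growth of `F` at `1` and the symmetries
prevent `τ` from having a limit in `Q` at any boundary point or at infinity
(`exists_tendsto_of_tendsto_schwarzTriangle`). So the image is open and relatively closed in `Q`.
The set of values taken twice is open and relatively closed as well, and it misses `i`, hence it is
empty. -/

/-! ### Euler's integral and the hypergeometric equation -/

/-- The weight `1 / √(t (1 - t))`. -/
noncomputable def arcsineWeight (t : ℝ) : ℝ := t ^ (-(1 / 2) : ℝ) * (1 - t) ^ (-(1 / 2) : ℝ)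

/-- The plane cut along `[1, +∞)`. -/
def cutPlane : Set ℂ := {z : ℂ | z.re < 1 ∨ z.im ≠ 0}

/-- The derivative of `hypF`. -/
noncomputable def hypF' (z : ℂ) : ℂ :=
  1 / Real.pi * ∫ t : ℝ in (0 : ℝ)..1,
    ((arcsineWeight t * (t / 2) : ℝ) : ℂ) * (1 - (t : ℂ) * z) ^ (-(3 / 2) : ℂ)

theorem arcsineWeight_pos {t : ℝ} (ht : t ∈ Ioo (0 : ℝ) 1) : 0 < arcsineWeight t :=
  mul_pos (Real.rpow_pos_of_pos ht.1 _) (Real.rpow_pos_of_pos (sub_pos.2 ht.2) _)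

theorem ofReal_arcsineWeight {t : ℝ} (ht : t ∈ Icc (0 : ℝ) 1) :
    (arcsineWeight t : ℂ) =
      (t : ℂ) ^ ((1 / 2 : ℂ) - 1) * (1 - (t : ℂ)) ^ ((1 : ℂ) - 1 / 2 - 1) := by
  rw [arcsineWeight, ofReal_mul, ofReal_cpow ht.1, ofReal_cpow (sub_nonneg.2 ht.2)]
  push_cast
  norm_num

theorem hypF_eq (z : ℂ) :
    hypF z = 1 / Real.pi * ∫ t : ℝ in (0 : ℝ)..1,
      (arcsineWeight t : ℂ) * (1 - (t : ℂ) * z) ^ (-(1 / 2) : ℂ) := by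
  rw [hypF, gaussHG, show (1 : ℂ) - 1 / 2 = 1 / 2 by norm_num, Complex.Gamma_one_half_eq,
    ← cpow_add _ _ (by exact_mod_cast Real.pi_pos.ne'), Gamma_one]
  norm_num only [cpow_one]
  congr 1
  refine intervalIntegral.integral_congr fun t ht => ?_
  rw [uIcc_of_le zero_le_one] at ht
  have := ofReal_arcsineWeight ht
  simp only [this]
  norm_num

theorem intervalIntegrable_arcsineWeight :
    IntervalIntegrable arcsineWeight MeasureTheory.volume 0 1 := by
  have h := betaIntegral_convergent (u := 1 / 2) (v := 1 / 2) (by norm_num) (by norm_num)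
  have h2 : IntervalIntegrable (fun t : ℝ => (arcsineWeight t : ℂ)) MeasureTheory.volume 0 1 := by
    refine IntervalIntegrable.congr (fun t ht => ?_) h
    rw [uIoc_of_le zero_le_one] at ht
    simp only [ofReal_arcsineWeight (Ioc_subset_Icc_self ht)]
    norm_num
  have h3 := h2.1.re
  have h4 := h2.2.re
  simp only [RCLike.re_to_complex, ofReal_re] at h3 h4
  exact ⟨h3, h4⟩

theorem isOpen_cutPlane : IsOpen cutPlane :=
  (isOpen_lt continuous_re continuous_const).union (isOpen_ne_fun continuous_im continuous_const)

theorem one_sub_mul_mem_slitPlane {z : ℂ} (hz : z ∈ cutPlane) {t : ℝ} (ht : t ∈ Icc (0 : ℝ) 1) :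
    1 - (t : ℂ) * z ∈ slitPlane := by
  obtain ⟨h0, h1⟩ := ht
  rw [mem_slitPlane_iff]
  simp only [sub_re, one_re, mul_re, ofReal_re, ofReal_im, zero_mul, sub_zero, sub_im, one_im,
    mul_im, add_zero, zero_sub, neg_ne_zero, sub_pos, mul_ne_zero_iff]
  rcases h0.eq_or_lt with rfl | h0
  · left; simp
  · rcases hz with hz | hz
    · left; nlinarith
    · right; exact ⟨h0.ne', hz⟩

theorem continuousOn_one_sub_mul_cpow {z : ℂ} (hz : z ∈ cutPlane) (e : ℂ) :
    ContinuousOn (fun t : ℝ => (1 - (t : ℂ) * z) ^ e) (Icc 0 1) :=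
  ContinuousOn.cpow_const (by fun_prop) fun _ ht => one_sub_mul_mem_slitPlane hz ht

theorem intervalIntegrable_weight_mul_cpow {k : ℝ → ℝ}
    (hk : IntervalIntegrable k MeasureTheory.volume 0 1) {z : ℂ} (hz : z ∈ cutPlane) (e : ℂ) :
    IntervalIntegrable (fun t : ℝ => (k t : ℂ) * (1 - (t : ℂ) * z) ^ e)
      MeasureTheory.volume 0 1 := by
  have hk' : IntervalIntegrable (fun t : ℝ => (k t : ℂ)) MeasureTheory.volume 0 1 :=
    ⟨hk.1.ofReal, hk.2.ofReal⟩
  refine hk'.mul_continuousOn ?_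
  rw [uIcc_of_le zero_le_one]
  exact continuousOn_one_sub_mul_cpow hz e

/-- A general weight allows one differentiation under the integral to serve both `hypF` and `hypF'`.
-/
theorem hasDerivAt_integral_weight_mul_cpow {k : ℝ → ℝ}
    (hk : IntervalIntegrable k MeasureTheory.volume 0 1) {z₀ : ℂ} (hz₀ : z₀ ∈ cutPlane) (a : ℂ) :
    HasDerivAt (fun z => ∫ t : ℝ in (0 : ℝ)..1, (k t : ℂ) * (1 - (t : ℂ) * z) ^ (-a))
      (∫ t : ℝ in (0 : ℝ)..1, (k t : ℂ) * (a * t * (1 - (t : ℂ) * z₀) ^ (-a - 1))) z₀ := by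
  have hk' : IntervalIntegrable (fun t : ℝ => (k t : ℂ)) MeasureTheory.volume 0 1 :=
    ⟨hk.1.ofReal, hk.2.ofReal⟩
  have hle : ∀ t ∈ Set.uIoc (0 : ℝ) 1, t ∈ Icc (0 : ℝ) 1 := by
    intro t ht
    rw [Set.uIoc_of_le zero_le_one] at ht
    exact Ioc_subset_Icc_self ht
  obtain ⟨r, hr, hball⟩ := Metric.isOpen_iff.mp isOpen_cutPlane z₀ hz₀
  have hr2 : Metric.closedBall z₀ (r / 2) ⊆ cutPlane :=
    (Metric.closedBall_subset_ball (half_lt_self hr)).trans hball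
  have hcont : ContinuousOn (fun p : ℂ × ℝ => a * (p.2 : ℂ) * (1 - (p.2 : ℂ) * p.1) ^ (-a - 1))
      (Metric.closedBall z₀ (r / 2) ×ˢ Icc (0 : ℝ) 1) := by
    refine ContinuousOn.mul (by fun_prop) (ContinuousOn.cpow_const (by fun_prop) ?_)
    rintro ⟨z, t⟩ ⟨hz, ht⟩
    exact one_sub_mul_mem_slitPlane (hr2 hz) ht
  obtain ⟨C, hC⟩ :=
    ((isCompact_closedBall z₀ (r / 2)).prod isCompact_Icc).exists_bound_of_continuousOn hcont
  have hmem : Metric.closedBall z₀ (r / 2) ∈ nhds z₀ := Metric.closedBall_mem_nhds _ (by positivity)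
  refine (intervalIntegral.hasDerivAt_integral_of_dominated_loc_of_deriv_le
    (μ := MeasureTheory.volume) (a := 0) (b := 1) (x₀ := z₀)
    (F := fun z (t : ℝ) => (k t : ℂ) * (1 - (t : ℂ) * z) ^ (-a))
    (F' := fun z (t : ℝ) => (k t : ℂ) * (a * t * (1 - (t : ℂ) * z) ^ (-a - 1)))
    (bound := fun t => ‖(k t : ℂ)‖ * C) hmem
    (Filter.mem_of_superset hmem fun z hz =>
      (intervalIntegrable_weight_mul_cpow hk (hr2 hz) (-a)).def'.aestronglyMeasurable)
    (intervalIntegrable_weight_mul_cpow hk hz₀ (-a)) ?_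
    (Filter.Eventually.of_forall fun t ht z hz => ?_)
    (hk'.norm.mul_const _)
    (Filter.Eventually.of_forall fun t ht z hz => ?_)).2
  · refine (hk'.mul_continuousOn ?_).def'.aestronglyMeasurable
    rw [uIcc_of_le zero_le_one]
    exact ContinuousOn.mul (by fun_prop) (continuousOn_one_sub_mul_cpow hz₀ _)
  · rw [norm_mul]
    gcongr
    exact hC (z, t) ⟨hz, hle t ht⟩
  · refine HasDerivAt.const_mul _ ?_
    have h1 : HasDerivAt (fun z : ℂ => 1 - (t : ℂ) * z) (-(t : ℂ)) z := by
      simpa using ((hasDerivAt_id z).const_mul (t : ℂ)).const_sub 1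
    have h2 := h1.cpow_const (c := -a) (one_sub_mul_mem_slitPlane (hr2 hz) (hle t ht))
    rw [show a * t * (1 - (t : ℂ) * z) ^ (-a - 1) = -a * (1 - (t : ℂ) * z) ^ (-a - 1) * -(t : ℂ) by
      ring]
    exact h2

theorem intervalIntegrable_arcsineWeight_mul {g : ℝ → ℝ} (hg : Continuous g) :
    IntervalIntegrable (fun t => arcsineWeight t * g t) MeasureTheory.volume 0 1 :=
  intervalIntegrable_arcsineWeight.mul_continuousOn hg.continuousOn

theorem hasDerivAt_hypF {z : ℂ} (hz : z ∈ cutPlane) : HasDerivAt hypF (hypF' z) z := by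
  have h := (hasDerivAt_integral_weight_mul_cpow intervalIntegrable_arcsineWeight hz
    (1 / 2)).const_mul (1 / Real.pi : ℂ)
  rw [show hypF = _ from funext hypF_eq, hypF']
  refine h.congr_deriv (congrArg _ (intervalIntegral.integral_congr fun t _ => ?_))
  push_cast
  norm_num
  ring

theorem cpow_neg_half_step {u : ℂ} (hu : u ≠ 0) :
    u ^ (-(1 / 2) : ℂ) = u ^ (-(5 / 2) : ℂ) * u ^ 2 ∧
      u ^ (-(3 / 2) : ℂ) = u ^ (-(5 / 2) : ℂ) * u := by
  constructor
  · rw [← cpow_natCast, ← cpow_add _ _ hu]; norm_num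
  · nth_rw 3 [← cpow_one u]
    rw [← cpow_add _ _ hu]; norm_num

theorem hasDerivAt_arcsine_primitive {t : ℝ} (ht : t ∈ Ioo (0 : ℝ) 1) :
    HasDerivAt (fun t : ℝ => √(t * (1 - t))) (arcsineWeight t * (1 - 2 * t) / 2) t ∧
      √(t * (1 - t)) = arcsineWeight t * (t * (1 - t)) := by
  have hp : 0 < t * (1 - t) := mul_pos ht.1 (sub_pos.2 ht.2)
  have hw : arcsineWeight t = 1 / √(t * (1 - t)) := by
    rw [arcsineWeight, ← Real.mul_rpow ht.1.le (sub_nonneg.2 ht.2.le), Real.rpow_neg hp.le,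
      Real.sqrt_eq_rpow, one_div, one_div]
  constructor
  · have h : HasDerivAt (fun t : ℝ => t * (1 - t)) (1 - 2 * t) t := by
      have := (hasDerivAt_id t).mul ((hasDerivAt_id t).const_sub 1)
      exact this.congr_deriv (by simp; ring)
    convert h.sqrt hp.ne' using 1
    rw [hw]; field_simp
  · rw [hw]
    have := Real.mul_self_sqrt hp.le
    field_simp
    rw [Real.sq_sqrt hp.le]

/-- The hypergeometric equation for `hypF`, in self-adjoint form. -/
theorem hasDerivAt_hypF'_selfAdjoint {z : ℂ} (hz : z ∈ cutPlane) :
    HasDerivAt (fun z => z * (1 - z) * hypF' z) (hypF z / 4) z := by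
  have hk := intervalIntegrable_arcsineWeight_mul (g := fun t => t / 2) (by fun_prop)
  have h := (hasDerivAt_integral_weight_mul_cpow hk hz (3 / 2)).const_mul (1 / Real.pi : ℂ)
  have hq : HasDerivAt (fun z : ℂ => z * (1 - z)) (1 - 2 * z) z := by
    have := (hasDerivAt_id z).mul ((hasDerivAt_id z).const_sub 1)
    exact this.congr_deriv (by simp; ring)
  have hm := hq.mul h
  refine hm.congr_deriv ?_
  rw [hypF_eq]
  have hI1 := intervalIntegrable_weight_mul_cpow hk hz (-(3 / 2))
  have hI0 := intervalIntegrable_weight_mul_cpow intervalIntegrable_arcsineWeight hz (-(1 / 2))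
  have hk2 := intervalIntegrable_arcsineWeight_mul (g := fun t => 3 / 4 * t ^ 2) (by fun_prop)
  have hI2 := intervalIntegrable_weight_mul_cpow hk2 hz (-(5 / 2))
  have e2 : ∀ t : ℝ, ((arcsineWeight t * (t / 2) : ℝ) : ℂ) *
      ((3 / 2 : ℂ) * t * (1 - (t : ℂ) * z) ^ (-(3 / 2 : ℂ) - 1)) =
      ((arcsineWeight t * (3 / 4 * t ^ 2) : ℝ) : ℂ) * (1 - (t : ℂ) * z) ^ (-(5 / 2) : ℂ) := by
    intro t
    push_cast
    norm_num
    ring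
  simp only [e2]
  -- The defect of the equation, under the integral sign, is the exact `t`-derivative of `-½
  -- √(t(1-t)) (1-tz)^(-3/2)`, which vanishes at both endpoints.
  have hFTC := intervalIntegral.integral_eq_sub_of_hasDerivAt_of_le (zero_le_one (α := ℝ))
    (f := fun t : ℝ => -(1 / 2 : ℂ) * ((√(t * (1 - t)) : ℝ) * (1 - (t : ℂ) * z) ^ (-(3 / 2) : ℂ)))
    (f' := fun t : ℝ => (1 - 2 * z) * (((arcsineWeight t * (t / 2) : ℝ) : ℂ) *
        (1 - (t : ℂ) * z) ^ (-(3 / 2) : ℂ)) + z * (1 - z) *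
        (((arcsineWeight t * (3 / 4 * t ^ 2) : ℝ) : ℂ) * (1 - (t : ℂ) * z) ^ (-(5 / 2) : ℂ)) -
        1 / 4 * ((arcsineWeight t : ℂ) * (1 - (t : ℂ) * z) ^ (-(1 / 2) : ℂ)))
    (continuousOn_const.mul (ContinuousOn.mul
      (Continuous.continuousOn (by fun_prop)) (continuousOn_one_sub_mul_cpow hz _)))
    (by
      intro t ht
      have hs := one_sub_mul_mem_slitPlane hz (Ioo_subset_Icc_self ht)
      have h1 : HasDerivAt (fun t : ℝ => 1 - (t : ℂ) * z) (-z) t := by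
        simpa using ((hasDerivAt_id t).ofReal_comp.mul_const z).const_sub 1
      have h2 := ((hasDerivAt_id (1 - (t : ℂ) * z)).cpow_const (c := -(3 / 2)) hs).comp t h1
      obtain ⟨h3, h4⟩ := hasDerivAt_arcsine_primitive ht
      have h5 := (h3.ofReal_comp.mul h2).const_mul (-(1 / 2) : ℂ)
      refine h5.congr_deriv ?_
      obtain ⟨c1, c2⟩ := cpow_neg_half_step (slitPlane_ne_zero hs)
      have c3 : (-(3 / 2) - 1 : ℂ) = -(5 / 2) := by norm_num
      simp only [id, Function.comp_apply, c3, h4]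
      rw [c1, c2]
      push_cast
      ring)
    (((hI1.const_mul _).add (hI2.const_mul _)).sub (hI0.const_mul _))
  rw [intervalIntegral.integral_sub ((hI1.const_mul _).add (hI2.const_mul _)) (hI0.const_mul _),
    intervalIntegral.integral_add (hI1.const_mul _) (hI2.const_mul _)] at hFTC
  simp only [intervalIntegral.integral_const_mul] at hFTC
  norm_num at hFTC
  norm_num
  linear_combination (1 / Real.pi : ℂ) * hFTC

/-! ### Branches of the inverse square root and Pfaff's transformation -/

theorem cpow_neg_half_sq {u : ℂ} (hu : u ≠ 0) : (u ^ (-(1 / 2) : ℂ)) ^ 2 = u⁻¹ := by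
  rw [sq, ← cpow_add _ _ hu]
  norm_num [cpow_neg_one]

theorem cpow_neg_half_re_pos {u : ℂ} (hu : u ∈ slitPlane) : 0 < (u ^ (-(1 / 2) : ℂ)).re := by
  rw [cpow_def_of_ne_zero (slitPlane_ne_zero hu), exp_re]
  refine mul_pos (Real.exp_pos _) (Real.cos_pos_of_mem_Ioo ?_)
  have h1 := (mem_slitPlane_iff_arg.1 hu).1
  have h2 := neg_pi_lt_arg u
  have h3 := (arg_le_pi u).lt_of_ne h1
  have : (log u * (-(1 / 2) : ℂ)).im = -arg u / 2 := by
    have e : (-(1 / 2) : ℂ) = ((-(1 / 2) : ℝ) : ℂ) := by push_cast; rfl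
    rw [e, im_mul_ofReal, log_im]; ring
  rw [this]
  constructor <;> linarith

/-- Compare imaginary parts: `2 Re v Im v = -Im u / |u|²`. -/
theorem im_sign_of_sq_eq_inv {u v : ℂ} (hv : 0 < v.re) (h : v ^ 2 = u⁻¹) :
    (u.im < 0 → 0 < v.im) ∧ (0 < u.im → v.im < 0) ∧ (u.im ≤ 0 → 0 ≤ v.im) ∧ (u.im = 0 → v.im = 0) := by
  have h2 : 2 * v.re * v.im = -u.im / normSq u := by
    rw [← inv_im, ← h, sq, mul_im]; ring
  refine ⟨fun hu => ?_, fun hu => ?_, fun hu => ?_, fun hu => ?_⟩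
  · have hn : 0 < normSq u := normSq_pos.2 (by rintro rfl; simp at hu)
    have : 0 < 2 * v.re * v.im := by rw [h2]; exact div_pos (by linarith) hn
    exact pos_of_mul_pos_right this (by positivity)
  · have hn : 0 < normSq u := normSq_pos.2 (by rintro rfl; simp at hu)
    have : 2 * v.re * v.im < 0 := by rw [h2]; exact div_neg_of_neg_of_pos (by linarith) hn
    exact neg_of_mul_neg_right this (by positivity)
  · have : 0 ≤ 2 * v.re * v.im := by rw [h2]; exact div_nonneg (by linarith) (normSq_nonneg u)
    exact nonneg_of_mul_nonneg_right this (by positivity)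
  · rw [hu, neg_zero, zero_div] at h2
    exact (mul_eq_zero.1 h2).resolve_left (by positivity)

/-- The two sides have equal squares. With the wrong sign, multiplying by the conjugate of `y =
b^(-1/2)` gives `v |y|² = -x ȳ`; its right side has negative real part because `x` and `y` both lie
in the closed first quadrant with positive real part, while `Re v > 0`. -/
theorem div_cpow_neg_half {a b : ℂ} (ha : a ∈ slitPlane) (hb : b ∈ slitPlane)
    (hab : a / b ∈ slitPlane) (ha' : a.im ≤ 0) (hb' : b.im ≤ 0) :
    (a / b) ^ (-(1 / 2) : ℂ) * b ^ (-(1 / 2) : ℂ) = a ^ (-(1 / 2) : ℂ) := by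
  have ha0 := slitPlane_ne_zero ha
  have hb0 := slitPlane_ne_zero hb
  have hra := cpow_neg_half_re_pos ha
  have hrb := cpow_neg_half_re_pos hb
  have hr := cpow_neg_half_re_pos hab
  have sa := cpow_neg_half_sq ha0
  have sb := cpow_neg_half_sq hb0
  have s := cpow_neg_half_sq (slitPlane_ne_zero hab)
  have ia := (im_sign_of_sq_eq_inv hra sa).2.2.1 ha'
  have ib := (im_sign_of_sq_eq_inv hrb sb).2.2.1 hb'
  set x := a ^ (-(1 / 2) : ℂ)
  set y := b ^ (-(1 / 2) : ℂ)
  set v := (a / b) ^ (-(1 / 2) : ℂ)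
  have hsq : (v * y) ^ 2 = x ^ 2 := by
    rw [mul_pow, s, sb, sa]; field_simp
  rcases sq_eq_sq_iff_eq_or_eq_neg.1 hsq with h | h
  · exact h
  · exfalso
    have h1 : v * (normSq y : ℂ) = -(x * (starRingEnd ℂ) y) := by
      rw [normSq_eq_conj_mul_self]
      linear_combination (starRingEnd ℂ) y * h
    have h2 := congrArg re h1
    rw [re_mul_ofReal, neg_re, mul_re, conj_re, conj_im] at h2
    have h3 : 0 ≤ v.re * normSq y := mul_nonneg hr.le (normSq_nonneg _)
    nlinarith [mul_pos hra hrb, mul_nonneg ia ib]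

/-- The open upper half-plane. -/
def upperHalf : Set ℂ := {z : ℂ | 0 < z.im}

theorem isOpen_upperHalf : IsOpen upperHalf := isOpen_lt continuous_const continuous_im

theorem isPreconnected_upperHalf : IsPreconnected upperHalf :=
  (convex_halfSpace_im_gt 0).isPreconnected

theorem upperHalf_subset_cutPlane : upperHalf ⊆ cutPlane := fun _ hz => Or.inr (ne_of_gt hz)

theorem ne_zero_of_mem_upperHalf {z : ℂ} (hz : z ∈ upperHalf) : z ≠ 0 := by
  rintro rfl
  simp [upperHalf] at hz

theorem one_sub_ne_zero_of_mem_upperHalf {z : ℂ} (hz : z ∈ upperHalf) : 1 - z ≠ 0 := by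
  intro h
  rw [sub_eq_zero] at h
  simp [upperHalf, ← h] at hz

theorem one_sub_mem_slitPlane_of_mem_upperHalf {z : ℂ} (hz : z ∈ upperHalf) :
    1 - z ∈ slitPlane := by
  right
  simpa using (ne_of_gt hz)

theorem one_sub_mem_cutPlane {z : ℂ} (hz : z ∈ upperHalf) : 1 - z ∈ cutPlane := by
  right
  simpa using (ne_of_gt hz)

theorem one_sub_inv_mem_upperHalf {z : ℂ} (hz : z ∈ upperHalf) : (1 - z)⁻¹ ∈ upperHalf := by
  have h : 0 < normSq (1 - z) := normSq_pos.2 (one_sub_ne_zero_of_mem_upperHalf hz)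
  simp only [upperHalf, mem_ofPred_eq, inv_im, sub_im, one_im, zero_sub, neg_neg] at hz ⊢
  positivity

/-- Pfaff's transformation of `hypF`. -/
theorem hypF_pfaff {z : ℂ} (hz : z ∈ upperHalf) :
    (1 - z) ^ (-(1 / 2) : ℂ) * hypF (1 - (1 - z)⁻¹) = hypF z := by
  rw [hypF_eq, hypF_eq, mul_left_comm, ← intervalIntegral.integral_const_mul]
  congr 1
  -- Pfaff's substitution `t ↦ 1 - t`, under which the weight is invariant.
  have hsub := intervalIntegral.integral_comp_sub_left (a := 0) (b := 1)
    (fun t : ℝ => (arcsineWeight t : ℂ) * (1 - (t : ℂ) * z) ^ (-(1 / 2) : ℂ)) 1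
  rw [sub_self, sub_zero] at hsub
  rw [← hsub]
  refine intervalIntegral.integral_congr fun t ht => ?_
  rw [uIcc_of_le zero_le_one] at ht
  have ht' : 1 - t ∈ Icc (0 : ℝ) 1 := ⟨by linarith [ht.2], by linarith [ht.1]⟩
  have hw : arcsineWeight (1 - t) = arcsineWeight t := by
    rw [arcsineWeight, arcsineWeight, mul_comm, sub_sub_cancel]
  have h0 := one_sub_ne_zero_of_mem_upperHalf hz
  have key : 1 - (t : ℂ) * (1 - (1 - z)⁻¹) = (1 - ((1 - t : ℝ) : ℂ) * z) / (1 - z) := by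
    push_cast; field_simp; ring
  have h1 := one_sub_mul_mem_slitPlane (one_sub_mem_cutPlane (one_sub_inv_mem_upperHalf hz)) ht
  rw [key] at h1
  have him : z.im > 0 := hz
  have h2 := div_cpow_neg_half (one_sub_mul_mem_slitPlane (upperHalf_subset_cutPlane hz) ht')
    (one_sub_mem_slitPlane_of_mem_upperHalf hz) h1
    (by
      rw [sub_im, one_im, im_ofReal_mul]
      nlinarith [ht'.1]) (by simp [him.le])
  simp only [key, hw, ← h2]
  ring

/-! ### Solutions of the hypergeometric equation -/

/-- `f` solves, with derivative `f'`, the hypergeometric equation of parameters `1/2, 1/2, 1`. -/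
def IsHypSolution (f f' : ℂ → ℂ) (S : Set ℂ) : Prop :=
  ∀ z ∈ S, HasDerivAt f (f' z) z ∧ HasDerivAt (fun z => z * (1 - z) * f' z) (f z / 4) z

theorem isHypSolution_hypF : IsHypSolution hypF hypF' cutPlane := fun _ hz =>
  ⟨hasDerivAt_hypF hz, hasDerivAt_hypF'_selfAdjoint hz⟩

namespace IsHypSolution

variable {f f' g g' : ℂ → ℂ} {S : Set ℂ}

theorem mono {T : Set ℂ} (hf : IsHypSolution f f' S) (h : T ⊆ S) : IsHypSolution f f' T :=
  fun z hz => hf z (h hz)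

theorem sub (hf : IsHypSolution f f' S) (hg : IsHypSolution g g' S) :
    IsHypSolution (fun z => f z - g z) (fun z => f' z - g' z) S := by
  intro z hz
  refine ⟨(hf z hz).1.sub (hg z hz).1, ?_⟩
  have h := (hf z hz).2.sub (hg z hz).2
  refine (h.congr_deriv (by ring)).congr_of_eventuallyEq (Filter.Eventually.of_forall fun y => ?_)
  simp only [Pi.sub_apply]
  ring

theorem const_mul (hf : IsHypSolution f f' S) (c : ℂ) :
    IsHypSolution (fun z => c * f z) (fun z => c * f' z) S := by
  intro z hz
  refine ⟨(hf z hz).1.const_mul c, ?_⟩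
  have h := (hf z hz).2.const_mul c
  refine (h.congr_deriv (by ring)).congr_of_eventuallyEq (Filter.Eventually.of_forall fun y => ?_)
  ring

theorem one_sub (hf : IsHypSolution f f' S) :
    IsHypSolution (fun z => f (1 - z)) (fun z => -f' (1 - z)) {z | 1 - z ∈ S} := by
  intro z hz
  have h1 : HasDerivAt (fun z : ℂ => 1 - z) (-1) z := (hasDerivAt_id z).const_sub 1
  obtain ⟨ha, hb⟩ := hf _ hz
  refine ⟨(ha.comp z h1).congr_deriv (by ring), ?_⟩
  have h := (hb.comp z h1).neg
  refine (h.congr_deriv (by ring)).congr_of_eventuallyEq (Filter.Eventually.of_forall fun y => ?_)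
  simp only [Pi.neg_apply, Function.comp_apply]
  ring

theorem one_sub_inv (hf : IsHypSolution f f' upperHalf) :
    IsHypSolution (fun z => (1 - z) ^ (-(1 / 2) : ℂ) * f (1 - z)⁻¹)
      (fun z => (1 - z) ^ (-(1 / 2) : ℂ) *
        ((1 - z)⁻¹ / 2 * f (1 - z)⁻¹ + (1 - z)⁻¹ ^ 2 * f' (1 - z)⁻¹)) upperHalf := by
  intro z hz
  have h0 := one_sub_ne_zero_of_mem_upperHalf hz
  have h1 : HasDerivAt (fun z : ℂ => 1 - z) (-1) z := (hasDerivAt_id z).const_sub 1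
  have hs : HasDerivAt (fun z : ℂ => (1 - z) ^ (-(1 / 2) : ℂ))
      ((1 - z) ^ (-(1 / 2) : ℂ) * ((1 - z)⁻¹ / 2)) z := by
    refine (h1.cpow_const (c := -(1 / 2))
      (one_sub_mem_slitPlane_of_mem_upperHalf hz)).congr_deriv ?_
    rw [cpow_sub _ _ h0, cpow_one]
    field_simp
  have hw : HasDerivAt (fun z : ℂ => (1 - z)⁻¹) ((1 - z)⁻¹ ^ 2) z :=
    (h1.inv h0).congr_deriv (by field_simp)
  obtain ⟨ha, hb⟩ := hf _ (one_sub_inv_mem_upperHalf hz)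
  have ha' := ha.comp z hw
  have hb' := hb.comp z hw
  refine ⟨(hs.mul ha').congr_deriv (by simp only [Function.comp_apply]; ring), ?_⟩
  -- No derivative of `f'` itself is at hand. With `w = 1/(1-z)` one has `zw = -(1-z) · w(1-w)`, so
  -- the new flux is expressed through `w(1-w) f'(w)`, whose derivative is known.
  have h := hs.mul ((((hasDerivAt_id z).mul ha').div_const 2).sub (h1.mul hb'))
  have ev : ∀ᶠ y in nhds z, y ∈ upperHalf := isOpen_upperHalf.mem_nhds hz
  refine (h.congr_of_eventuallyEq ?_).congr_deriv ?_
  · filter_upwards [ev] with y hy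
    have hy0 := one_sub_ne_zero_of_mem_upperHalf hy
    simp only [Pi.mul_apply, Pi.sub_apply, Function.comp_apply, id]
    field_simp
    ring
  · simp only [Pi.mul_apply, Pi.sub_apply, Function.comp_apply, id]
    field_simp
    ring

/-- Abel's identity: in self-adjoint form the cross terms cancel and the weighted Wronskian has
derivative zero. -/
theorem wronskian_eq (hf : IsHypSolution f f' S) (hg : IsHypSolution g g' S) (hS : IsOpen S)
    (hS' : IsPreconnected S) {z w : ℂ} (hz : z ∈ S) (hw : w ∈ S) :
    z * (1 - z) * (f z * g' z - g z * f' z) = w * (1 - w) * (f w * g' w - g w * f' w) := by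
  have hd : ∀ z ∈ S, HasDerivAt
      (fun z => f z * (z * (1 - z) * g' z) - g z * (z * (1 - z) * f' z)) 0 z := by
    intro z hz
    obtain ⟨ha, hb⟩ := hf z hz
    obtain ⟨hc, hd⟩ := hg z hz
    exact ((ha.mul hd).sub (hc.mul hb)).congr_deriv (by ring)
  have := hS.is_const_of_deriv_eq_zero hS'
    (fun z hz => (hd z hz).differentiableAt.differentiableWithinAt)
    (fun z hz => (hd z hz).deriv) hz hw
  linear_combination this

/-- Uniqueness for the initial value problem, by reduction of order: the Wronskian with a zero-free
solution `g` vanishes, so `f / g` is constant. -/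
theorem eq_zero (hf : IsHypSolution f f' upperHalf) (hg : IsHypSolution g g' upperHalf)
    (hg0 : ∀ z ∈ upperHalf, g z ≠ 0) {a : ℂ} (ha : a ∈ upperHalf) (h0 : f a = 0) (h1 : f' a = 0)
    {z : ℂ} (hz : z ∈ upperHalf) : f z = 0 := by
  have hd : ∀ z ∈ upperHalf, HasDerivAt (fun z => f z / g z) 0 z := by
    intro z hz
    refine ((hf z hz).1.div (hg z hz).1 (hg0 z hz)).congr_deriv ?_
    have hW := hf.wronskian_eq hg isOpen_upperHalf isPreconnected_upperHalf hz ha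
    rw [h0, h1] at hW
    have hz2 := mul_ne_zero (ne_zero_of_mem_upperHalf hz) (one_sub_ne_zero_of_mem_upperHalf hz)
    have : f z * g' z - g z * f' z = 0 := by
      refine (mul_eq_zero.1 (hW.trans ?_)).resolve_left hz2
      ring
    rw [div_eq_zero_iff]
    left
    linear_combination -this
  have := isOpen_upperHalf.is_const_of_deriv_eq_zero isPreconnected_upperHalf
    (fun z hz => (hd z hz).differentiableAt.differentiableWithinAt)
    (fun z hz => (hd z hz).deriv) hz ha
  simp only [h0, zero_div, div_eq_zero_iff] at this
  exact this.resolve_right (hg0 z hz)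

end IsHypSolution

/-! ### Signs, monotonicity and logarithmic growth of `hypF` -/

theorem re_integral_weight_mul {k : ℝ → ℝ} {v : ℝ → ℂ}
    (h : IntervalIntegrable (fun t => (k t : ℂ) * v t) MeasureTheory.volume 0 1) :
    (1 / Real.pi * ∫ t : ℝ in (0 : ℝ)..1, (k t : ℂ) * v t).re =
      1 / Real.pi * ∫ t : ℝ in (0 : ℝ)..1, k t * (v t).re := by
  have h1 := reCLM.intervalIntegral_comp_comm h
  simp only [reCLM_apply, re_ofReal_mul] at h1
  rw [h1, show (1 / Real.pi : ℂ) = ((1 / Real.pi : ℝ) : ℂ) by push_cast; rfl, re_ofReal_mul]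

theorem im_integral_weight_mul {k : ℝ → ℝ} {v : ℝ → ℂ}
    (h : IntervalIntegrable (fun t => (k t : ℂ) * v t) MeasureTheory.volume 0 1) :
    (1 / Real.pi * ∫ t : ℝ in (0 : ℝ)..1, (k t : ℂ) * v t).im =
      1 / Real.pi * ∫ t : ℝ in (0 : ℝ)..1, k t * (v t).im := by
  have h1 := imCLM.intervalIntegral_comp_comm h
  simp only [imCLM_apply, im_ofReal_mul] at h1
  rw [h1, show (1 / Real.pi : ℂ) = ((1 / Real.pi : ℝ) : ℂ) by push_cast; rfl, im_ofReal_mul]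

theorem IntervalIntegrable.weight_mul_re {k : ℝ → ℝ} {v : ℝ → ℂ} {a b : ℝ}
    (h : IntervalIntegrable (fun t => (k t : ℂ) * v t) MeasureTheory.volume a b) :
    IntervalIntegrable (fun t => k t * (v t).re) MeasureTheory.volume a b := by
  have h3 := h.1.re
  have h4 := h.2.re
  simp only [RCLike.re_to_complex, re_ofReal_mul] at h3 h4
  exact ⟨h3, h4⟩

theorem IntervalIntegrable.weight_mul_im {k : ℝ → ℝ} {v : ℝ → ℂ} {a b : ℝ}
    (h : IntervalIntegrable (fun t => (k t : ℂ) * v t) MeasureTheory.volume a b) :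
    IntervalIntegrable (fun t => k t * (v t).im) MeasureTheory.volume a b := by
  have h3 := h.1.im
  have h4 := h.2.im
  simp only [RCLike.im_to_complex, im_ofReal_mul] at h3 h4
  exact ⟨h3, h4⟩

theorem intervalIntegrable_hypF_integrand {z : ℂ} (hz : z ∈ cutPlane) :
    IntervalIntegrable (fun t : ℝ => (arcsineWeight t : ℂ) * (1 - (t : ℂ) * z) ^ (-(1 / 2) : ℂ))
      MeasureTheory.volume 0 1 :=
  intervalIntegrable_weight_mul_cpow intervalIntegrable_arcsineWeight hz _

theorem integrand_sq {z : ℂ} (hz : z ∈ cutPlane) {t : ℝ} (ht : t ∈ Icc (0 : ℝ) 1) :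
    0 < ((1 - (t : ℂ) * z) ^ (-(1 / 2) : ℂ)).re ∧
      ((1 - (t : ℂ) * z) ^ (-(1 / 2) : ℂ)) ^ 2 = (1 - (t : ℂ) * z)⁻¹ :=
  have h := one_sub_mul_mem_slitPlane hz ht
  ⟨cpow_neg_half_re_pos h, cpow_neg_half_sq (slitPlane_ne_zero h)⟩

theorem hypF_re_pos {z : ℂ} (hz : z ∈ cutPlane) : 0 < (hypF z).re := by
  have h := intervalIntegrable_hypF_integrand hz
  rw [hypF_eq, re_integral_weight_mul h]
  refine mul_pos (by positivity) (intervalIntegral.intervalIntegral_pos_of_pos_on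
    h.weight_mul_re (fun t ht => ?_) one_pos)
  exact mul_pos (arcsineWeight_pos ht) (integrand_sq hz (Ioo_subset_Icc_self ht)).1

theorem hypF_ne_zero {z : ℂ} (hz : z ∈ cutPlane) : hypF z ≠ 0 := by
  intro h
  simpa [h] using hypF_re_pos hz

theorem hypF_im_pos {z : ℂ} (hz : 0 < z.im) : 0 < (hypF z).im := by
  have hz' : z ∈ cutPlane := Or.inr hz.ne'
  have h := intervalIntegrable_hypF_integrand hz'
  rw [hypF_eq, im_integral_weight_mul h]
  refine mul_pos (by positivity) (intervalIntegral.intervalIntegral_pos_of_pos_on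
    h.weight_mul_im (fun t ht => ?_) one_pos)
  obtain ⟨h1, h2⟩ := integrand_sq hz' (Ioo_subset_Icc_self ht)
  exact mul_pos (arcsineWeight_pos ht) ((im_sign_of_sq_eq_inv h1 h2).1
    (by simpa [im_ofReal_mul] using mul_pos ht.1 hz))

theorem hypF_im_neg {z : ℂ} (hz : z.im < 0) : (hypF z).im < 0 := by
  have hz' : z ∈ cutPlane := Or.inr hz.ne
  have h := intervalIntegrable_hypF_integrand hz'
  rw [hypF_eq, im_integral_weight_mul h, ← neg_pos, ← mul_neg, ← intervalIntegral.integral_neg]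
  refine mul_pos (by positivity) (intervalIntegral.intervalIntegral_pos_of_pos_on
    h.weight_mul_im.neg (fun t ht => ?_) one_pos)
  obtain ⟨h1, h2⟩ := integrand_sq hz' (Ioo_subset_Icc_self ht)
  exact neg_pos.2 (mul_neg_of_pos_of_neg (arcsineWeight_pos ht) ((im_sign_of_sq_eq_inv h1 h2).2.1
    (by simpa [im_ofReal_mul] using mul_neg_of_pos_of_neg ht.1 hz)))

theorem hypF_ofReal_im {x : ℝ} (hx : x < 1) : (hypF x).im = 0 := by
  have hz' : (x : ℂ) ∈ cutPlane := Or.inl hx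
  have h := intervalIntegrable_hypF_integrand hz'
  rw [hypF_eq, im_integral_weight_mul h]
  have : ∫ t : ℝ in (0 : ℝ)..1,
      arcsineWeight t * ((1 - (t : ℂ) * x) ^ (-(1 / 2) : ℂ)).im = ∫ t : ℝ in (0 : ℝ)..1, 0 := by
    refine intervalIntegral.integral_congr fun t ht => ?_
    rw [uIcc_of_le zero_le_one] at ht
    obtain ⟨h1, h2⟩ := integrand_sq hz' ht
    have := (im_sign_of_sq_eq_inv h1 h2).2.2.2 (by simp)
    simp only [this, mul_zero]
  rw [this]
  simp

theorem cpow_neg_half_ofReal_lt {a b : ℝ} (ha : 0 < a) (hab : a < b) :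
    ((b : ℂ) ^ (-(1 / 2) : ℂ)).re < ((a : ℂ) ^ (-(1 / 2) : ℂ)).re := by
  have e : (-(1 / 2) : ℂ) = ((-(1 / 2) : ℝ) : ℂ) := by push_cast; rfl
  rw [e, ← ofReal_cpow ha.le, ← ofReal_cpow (ha.trans hab).le, ofReal_re, ofReal_re]
  exact Real.rpow_lt_rpow_of_neg ha hab (by norm_num)

theorem hypF_ofReal_re_lt {x y : ℝ} (hxy : x < y) (hy : y < 1) : (hypF x).re < (hypF y).re := by
  have hx' : (x : ℂ) ∈ cutPlane := Or.inl (hxy.trans hy)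
  have hy' : (y : ℂ) ∈ cutPlane := Or.inl hy
  have h1 := intervalIntegrable_hypF_integrand hx'
  have h2 := intervalIntegrable_hypF_integrand hy'
  rw [hypF_eq, hypF_eq, re_integral_weight_mul h1, re_integral_weight_mul h2, ← sub_pos, ← mul_sub,
    ← intervalIntegral.integral_sub h2.weight_mul_re h1.weight_mul_re]
  refine mul_pos (by positivity) (intervalIntegral.intervalIntegral_pos_of_pos_on
    (h2.weight_mul_re.sub h1.weight_mul_re) (fun t ht => ?_) one_pos)
  rw [← mul_sub]
  refine mul_pos (arcsineWeight_pos ht) (sub_pos.2 ?_)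
  have := cpow_neg_half_ofReal_lt (a := 1 - t * y) (b := 1 - t * x)
    (by nlinarith [ht.1, ht.2]) (by nlinarith [ht.1])
  push_cast at this
  exact this

theorem hypF'_half_ne_zero : hypF' (1 / 2) ≠ 0 := by
  have hz : (1 / 2 : ℂ) ∈ cutPlane := Or.inl (by norm_num)
  have hk := intervalIntegrable_arcsineWeight_mul (g := fun t => t / 2) (by fun_prop)
  have h := intervalIntegrable_weight_mul_cpow hk hz (-(3 / 2))
  have : 0 < (hypF' (1 / 2)).re := by
    rw [hypF', re_integral_weight_mul h]
    refine mul_pos (by positivity) (intervalIntegral.intervalIntegral_pos_of_pos_on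
      h.weight_mul_re (fun t ht => ?_) one_pos)
    refine mul_pos (mul_pos (arcsineWeight_pos ht) (by linarith [ht.1])) ?_
    have hp : 0 < 1 - t * (1 / 2) := by linarith [ht.2]
    have e : (1 - (t : ℂ) * (1 / 2)) ^ (-(3 / 2) : ℂ) =
        (((1 - t * (1 / 2)) ^ (-(3 / 2) : ℝ) : ℝ) : ℂ) := by
      rw [ofReal_cpow hp.le]; push_cast; rfl
    rw [e, ofReal_re]
    positivity
  intro h0
  rw [h0, zero_re] at this
  exact this.false

/-- `hypF` blows up logarithmically at `1`. -/
theorem log_le_hypF_re {z : ℂ} (hz : z ∈ cutPlane) (h1 : ‖1 - z‖ < 1) :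
    1 / Real.pi * (1 / 2 * -Real.log ‖1 - z‖) ≤ (hypF z).re := by
  have h := intervalIntegrable_hypF_integrand hz
  rw [hypF_eq, re_integral_weight_mul h]
  refine mul_le_mul_of_nonneg_left ?_ (by positivity)
  set η := ‖1 - z‖ with hη
  have hη0 : 0 < η := by
    rw [hη, norm_pos_iff, sub_ne_zero]
    rintro rfl
    simp [cutPlane] at hz
  have hr := h.weight_mul_re
  have hsub : ∀ {a b : ℝ}, 0 ≤ a → a ≤ b → b ≤ 1 → IntervalIntegrable
      (fun t : ℝ => arcsineWeight t * ((1 - (t : ℂ) * z) ^ (-(1 / 2) : ℂ)).re)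
      MeasureTheory.volume a b := fun h0 h1 h2 => hr.mono_set (by
        rw [uIcc_of_le zero_le_one, uIcc_of_le h1]; exact Icc_subset_Icc h0 h2)
  have hA := hsub le_rfl (sub_nonneg.2 h1.le) (sub_le_self 1 hη0.le)
  have hB := hsub (sub_nonneg.2 h1.le) (sub_le_self 1 hη0.le) le_rfl
  -- The cut at `1 - η` keeps the part where `1 - t` dominates `t(1 - z)` in `1 - tz = (1 - t) + t(1
  -- - z)`; the remaining part is nonnegative.
  rw [← intervalIntegral.integral_add_adjacent_intervals hA hB]
  have hBpos : 0 ≤ ∫ t : ℝ in (1 - η)..1,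
      arcsineWeight t * ((1 - (t : ℂ) * z) ^ (-(1 / 2) : ℂ)).re := by
    refine intervalIntegral.integral_nonneg (sub_le_self 1 hη0.le) fun t ht => ?_
    have ht0 : 0 ≤ t := (sub_nonneg.2 h1.le).trans ht.1
    refine mul_nonneg ?_ (integrand_sq hz ⟨ht0, ht.2⟩).1.le
    exact mul_nonneg (Real.rpow_nonneg ht0 _) (Real.rpow_nonneg (sub_nonneg.2 ht.2) _)
  have hlog : ∫ t : ℝ in (0 : ℝ)..(1 - η), 1 / 2 * (1 - t)⁻¹ = 1 / 2 * -Real.log η := by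
    rw [intervalIntegral.integral_const_mul,
      intervalIntegral.integral_comp_sub_left (fun x : ℝ => x⁻¹) 1, sub_sub_cancel, sub_zero,
      integral_inv_of_pos hη0 one_pos, one_div η, Real.log_inv]
  rw [← hlog]
  refine le_add_of_le_of_nonneg (intervalIntegral.integral_mono_on_of_le_Ioo
    (sub_nonneg.2 h1.le) ?_ hA fun t ht => ?_) hBpos
  · refine ContinuousOn.intervalIntegrable ?_
    rw [uIcc_of_le (sub_nonneg.2 h1.le)]
    refine continuousOn_const.mul (ContinuousOn.inv₀ (by fun_prop) fun t ht => ?_)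
    have := ht.2
    linarith
  · have ht1 : η < 1 - t := by linarith [ht.2]
    have hpos : 0 < 1 - t := hη0.trans ht1
    have ht' : t ∈ Ioo (0 : ℝ) 1 := ⟨ht.1, by linarith⟩
    obtain ⟨v0, v1⟩ := integrand_sq hz (Ioo_subset_Icc_self ht')
    set v := (1 - (t : ℂ) * z) ^ (-(1 / 2) : ℂ)
    set u := 1 - (t : ℂ) * z with hu
    have hu' : u = ((1 - t : ℝ) : ℂ) + (t : ℂ) * (1 - z) := by rw [hu]; push_cast; ring
    have htz : ‖(t : ℂ) * (1 - z)‖ ≤ η := by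
      rw [norm_mul, norm_real, Real.norm_of_nonneg ht'.1.le]
      exact mul_le_of_le_one_left hη0.le ht'.2.le
    have hun : ‖u‖ ≤ 2 * (1 - t) := by
      rw [hu']
      refine (norm_add_le _ _).trans ?_
      rw [norm_real, Real.norm_of_nonneg hpos.le]
      linarith
    have hure : 0 ≤ u.re := by
      rw [hu', add_re, ofReal_re]
      have := (abs_le.1 ((abs_re_le_norm _).trans htz)).1
      linarith
    have hu0 : 0 < ‖u‖ := norm_pos_iff.2
      (slitPlane_ne_zero (one_sub_mul_mem_slitPlane hz (Ioo_subset_Icc_self ht')))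
    have hvre : 0 ≤ (v ^ 2).re := by
      rw [v1, inv_re]
      exact div_nonneg hure (normSq_nonneg u)
    have hvn : ‖v‖ ^ 2 = ‖u‖⁻¹ := by rw [← norm_pow, v1, norm_inv]
    -- From `Re (v²) ≥ 0` the real part carries at least half of `|v|² = 1/|u| ≥ 1/(2(1-t))`.
    have hbound : (4 * (1 - t))⁻¹ ≤ v.re ^ 2 := by
      have e1 : ‖v‖ ^ 2 = v.re ^ 2 + v.im ^ 2 := by rw [← normSq_eq_norm_sq, normSq_apply]; ring
      have e2 : (v ^ 2).re = v.re ^ 2 - v.im ^ 2 := by rw [sq, mul_re]; ring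
      have e3 : (2 * (1 - t))⁻¹ ≤ ‖u‖⁻¹ := inv_anti₀ hu0 hun
      have e4 : (4 * (1 - t))⁻¹ = (2 * (1 - t))⁻¹ / 2 := by field_simp; norm_num
      rw [e4]
      linarith
    have hw : (1 - t) ^ (-(1 / 2) : ℝ) ≤ arcsineWeight t :=
      le_mul_of_one_le_left (Real.rpow_nonneg hpos.le _)
        (Real.one_le_rpow_of_pos_of_le_one_of_nonpos ht'.1 ht'.2.le (by norm_num))
    have hs : ((1 - t) ^ (-(1 / 2) : ℝ)) ^ 2 = (1 - t)⁻¹ := by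
      rw [← Real.rpow_natCast, ← Real.rpow_mul hpos.le, ← Real.rpow_neg_one]
      norm_num
    have hsp : 0 < (1 - t) ^ (-(1 / 2) : ℝ) := Real.rpow_pos_of_pos hpos _
    set r := (1 - t) ^ (-(1 / 2) : ℝ)
    have hrv : r / 2 ≤ v.re := by
      refine le_of_sq_le_sq ?_ v0.le
      refine le_trans (le_of_eq ?_) hbound
      rw [div_pow, hs]; field_simp; norm_num
    calc 1 / 2 * (1 - t)⁻¹ = r * (r / 2) := by rw [← hs]; ring
      _ ≤ arcsineWeight t * v.re :=
        mul_le_mul hw hrv (by positivity) (arcsineWeight_pos ht').le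

/-! ### The connection formula and the functional equations of `schwarzTriangle` -/

/-- The difference of the two sides solves the equation, so it suffices that its value and
derivative vanish at `ρ`, which `z ↦ 1/(1-z)` fixes. Pfaff's identity and its derivative at `ρ`
express the data of `hypF` there through those at `1 - ρ`, leaving algebra in `s = (1-ρ)^(-1/2)`. -/
theorem hypF_connection_of_fixedPoint {ρ : ℂ} (hρ : ρ ∈ upperHalf) (hρ2 : ρ ^ 2 = ρ - 1) {z : ℂ}
    (hz : z ∈ upperHalf) :
    (1 - z) ^ (-(1 / 2) : ℂ) * hypF (1 - z)⁻¹ = hypF (1 - z) + I * hypF z := by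
  have hF : IsHypSolution hypF hypF' upperHalf := isHypSolution_hypF.mono upperHalf_subset_cutPlane
  have hR : IsHypSolution (fun z => hypF (1 - z)) (fun z => -hypF' (1 - z)) upperHalf :=
    isHypSolution_hypF.one_sub.mono fun z hz => one_sub_mem_cutPlane hz
  have hh := (hF.one_sub_inv.sub hR).sub (hF.const_mul I)
  have hw : (1 - ρ)⁻¹ = ρ := inv_eq_of_mul_eq_one_right (by linear_combination -hρ2)
  set s := (1 - ρ) ^ (-(1 / 2) : ℂ) with hs
  have hs0 := cpow_neg_half_re_pos (one_sub_mem_slitPlane_of_mem_upperHalf hρ)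
  have hs2 := cpow_neg_half_sq (one_sub_ne_zero_of_mem_upperHalf hρ)
  rw [← hs] at hs0 hs2
  rw [hw] at hs2
  -- Here `s² = ρ` and `ρ³ = -1`, so `s³ = ±i`; the condition `Re s > 0` selects the sign.
  have hs3 : s ^ 3 = I := by
    have h6 : (s ^ 3 - I) * (s ^ 3 + I) = 0 := by
      have : s ^ 6 = -1 := by
        rw [show s ^ 6 = (s ^ 2) ^ 3 by ring, hs2]
        linear_combination (ρ + 1) * hρ2
      linear_combination this - I_sq
    rcases mul_eq_zero.1 h6 with h | h
    · exact sub_eq_zero.1 h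
    · exfalso
      have hsρ : s * (normSq ρ : ℂ) = -I * (starRingEnd ℂ) ρ := by
        rw [normSq_eq_conj_mul_self, ← hs2]
        linear_combination (starRingEnd ℂ) (s ^ 2) * h
      have h2 := congrArg re hsρ
      rw [re_mul_ofReal] at h2
      simp only [neg_mul, neg_re, mul_re, I_re, I_im, conj_re, conj_im, zero_mul, one_mul,
        zero_sub, neg_neg] at h2
      have h3 : 0 < s.re * normSq ρ := mul_pos hs0 (normSq_pos.2 (ne_zero_of_mem_upperHalf hρ))
      have h4 : 0 < ρ.im := hρ
      linarith
  have hP : (fun z => (1 - z) ^ (-(1 / 2) : ℂ) * hypF (1 - (1 - z)⁻¹)) =ᶠ[nhds ρ] hypF := by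
    filter_upwards [isOpen_upperHalf.mem_nhds hρ] with y hy
    exact hypF_pfaff hy
  have hP0 := hypF_pfaff hρ
  have hP1 := (hR.one_sub_inv ρ hρ).1.unique
    ((hF ρ hρ).1.congr_of_eventuallyEq hP)
  rw [hw, ← hs] at hP0
  simp only [hw] at hP1
  rw [← hs] at hP1
  have hq : s ^ 4 = s ^ 2 - 1 := by
    rw [hs2, ← hρ2, ← hs2]; ring
  have key := hh.eq_zero hF (fun z hz => hypF_ne_zero (upperHalf_subset_cutPlane hz)) hρ
    (by
      simp only [hw]
      rw [← hs, ← hP0]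
      linear_combination s * hypF (1 - ρ) * hs3 - hypF (1 - ρ) * hq)
    (by
      simp only [hw]
      rw [← hs, ← hP1, ← hP0]
      generalize hypF (1 - ρ) = a
      generalize hypF' (1 - ρ) = b
      rw [← hs2]
      linear_combination s * (s ^ 2 / 2 * a - s ^ 4 * b) * hs3 +
        (a * s ^ 4 / 2 + b * (-s ^ 6 + s ^ 2 + 1)) * hq) hz
  linear_combination key

/-- The connection formula for `hypF`. -/
theorem hypF_connection {z : ℂ} (hz : z ∈ upperHalf) :
    (1 - z) ^ (-(1 / 2) : ℂ) * hypF (1 - z)⁻¹ = hypF (1 - z) + I * hypF z := by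
  refine hypF_connection_of_fixedPoint (ρ := ⟨1 / 2, √3 / 2⟩)
    (show (0 : ℝ) < √3 / 2 by positivity) ?_ hz
  have h3 : √3 * √3 = 3 := Real.mul_self_sqrt (by norm_num)
  apply Complex.ext
  · simp only [sq, mul_re, sub_re, one_re]; nlinarith
  · simp only [sq, mul_im, sub_im, one_im]; ring

theorem schwarzTriangle_one_sub (z : ℂ) : schwarzTriangle (1 - z) = -(schwarzTriangle z)⁻¹ := by
  rw [schwarzTriangle, schwarzTriangle, sub_sub_cancel, mul_inv, inv_div, inv_I]
  ring

theorem schwarzTriangle_one_sub_inv {z : ℂ} (hz : z ∈ upperHalf) :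
    schwarzTriangle (1 - (1 - z)⁻¹) = schwarzTriangle z - 1 := by
  have h1 := hypF_connection hz
  have h2 := hypF_pfaff hz
  have h0 := cpow_neg_half_re_pos (one_sub_mem_slitPlane_of_mem_upperHalf hz)
  have hs : (1 - z) ^ (-(1 / 2) : ℂ) ≠ 0 := by
    intro h
    rw [h, zero_re] at h0
    exact h0.false
  have hF := hypF_ne_zero (upperHalf_subset_cutPlane hz)
  rw [schwarzTriangle, sub_sub_cancel, ← mul_div_mul_left _ _ hs, h1, h2, schwarzTriangle]
  field_simp
  linear_combination hypF z * I_sq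

theorem one_sub_one_sub_inv_mem_upperHalf {z : ℂ} (hz : z.im < 0) :
    1 - (1 - z)⁻¹ ∈ upperHalf := by
  have hn : 0 < normSq (1 - z) := normSq_pos.2 fun h' => by
    rw [sub_eq_zero] at h'
    simp [← h'] at hz
  simp only [upperHalf, mem_ofPred_eq, sub_im, one_im, inv_im, zero_sub, neg_neg]
  rw [neg_pos]
  exact div_neg_of_neg_of_pos hz hn

theorem schwarzTriangle_one_sub_inv_of_im_neg {z : ℂ} (hz : z.im < 0) :
    schwarzTriangle (1 - (1 - z)⁻¹) = schwarzTriangle z + 1 := by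
  -- The map `z ↦ z/(z-1)` is an involution, so the translation law is read backwards.
  have e := schwarzTriangle_one_sub_inv (one_sub_one_sub_inv_mem_upperHalf hz)
  rw [sub_sub_cancel, inv_inv, sub_sub_cancel] at e
  rw [e, sub_add_cancel]

/-! ### The slit domain and local invertibility -/

theorem mem_slitDomain_iff {z : ℂ} : z ∈ slitDomain ↔ (0 < z.re ∧ z.re < 1) ∨ z.im ≠ 0 := by
  constructor
  · rintro (⟨x, hx, rfl⟩ | h)
    · exact Or.inl (by simpa using hx)
    · exact Or.inr h
  · intro h
    by_cases him : z.im = 0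
    · have h' := h.resolve_right (not_not.2 him)
      exact Or.inl ⟨z.re, h', Complex.ext (by simp) (by simp [him])⟩
    · exact Or.inr him

theorem isOpen_slitDomain : IsOpen slitDomain := by
  have : slitDomain = ({z : ℂ | 0 < z.re} ∩ {z | z.re < 1}) ∪ {z | z.im ≠ 0} := by
    ext z; exact mem_slitDomain_iff
  rw [this]
  exact ((isOpen_lt continuous_const continuous_re).inter
    (isOpen_lt continuous_re continuous_const)).union (isOpen_ne_fun continuous_im continuous_const)

theorem half_mem_slitDomain : (1 / 2 : ℂ) ∈ slitDomain :=
  mem_slitDomain_iff.2 (Or.inl (by norm_num))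

theorem isPreconnected_slitDomain : IsPreconnected slitDomain := by
  have : StarConvex ℝ (1 / 2 : ℂ) slitDomain := by
    intro z hz a b ha hb hab
    rw [mem_slitDomain_iff] at hz ⊢
    rcases hz with ⟨h1, h2⟩ | h
    · left
      have : (a • (1 / 2 : ℂ) + b • z).re = a / 2 + b * z.re := by simp [div_eq_mul_inv]
      rw [this]
      rcases hb.eq_or_lt with rfl | hb
      · constructor <;> linarith
      · constructor <;> nlinarith
    · rcases hb.eq_or_lt with rfl | hb
      · left
        rw [add_zero] at hab
        subst hab
        norm_num
      · right
        have : (a • (1 / 2 : ℂ) + b • z).im = b * z.im := by simp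
        rw [this]
        exact mul_ne_zero hb.ne' h
  exact (this.isPathConnected half_mem_slitDomain).isConnected.isPreconnected

theorem one_sub_mem_slitDomain {z : ℂ} (hz : z ∈ slitDomain) : 1 - z ∈ slitDomain := by
  rw [mem_slitDomain_iff] at *
  simp only [sub_re, one_re, sub_im, one_im, zero_sub, neg_ne_zero]
  refine hz.imp_left fun h => ?_
  constructor <;> linarith [h.1, h.2]

theorem slitDomain_subset_cutPlane : slitDomain ⊆ cutPlane := fun _ hz =>
  (mem_slitDomain_iff.1 hz).imp_left And.right

/-- The derivative is, up to a nonzero factor, the Wronskian of `F(1 - z)` and `F(z)` over `F(z)²`.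
The weighted Wronskian is constant, equal to `F(1/2) F'(1/2) / 2 ≠ 0`. -/
theorem hasDerivAt_schwarzTriangle {z : ℂ} (hz : z ∈ slitDomain) :
    ∃ d ≠ 0, HasDerivAt schwarzTriangle d z := by
  have hF : IsHypSolution hypF hypF' slitDomain :=
    isHypSolution_hypF.mono slitDomain_subset_cutPlane
  have hR : IsHypSolution (fun z => hypF (1 - z)) (fun z => -hypF' (1 - z)) slitDomain :=
    isHypSolution_hypF.one_sub.mono
      fun z hz => slitDomain_subset_cutPlane (one_sub_mem_slitDomain hz)
  have hF0 := hypF_ne_zero (slitDomain_subset_cutPlane hz)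
  refine ⟨_, ?_, ((hR z hz).1.div (hF z hz).1 hF0).const_mul I⟩
  have hW := hR.wronskian_eq hF isOpen_slitDomain isPreconnected_slitDomain hz half_mem_slitDomain
  refine mul_ne_zero I_ne_zero (div_ne_zero (fun h => ?_) (pow_ne_zero 2 hF0))
  have h1 := hypF_ne_zero (slitDomain_subset_cutPlane half_mem_slitDomain)
  rw [show (1 : ℂ) - 1 / 2 = 1 / 2 by norm_num] at hW
  refine mul_ne_zero h1 hypF'_half_ne_zero ?_
  linear_combination -2 * hW - 2 * z * (1 - z) * h

theorem hasStrictDerivAt_schwarzTriangle {z : ℂ} (hz : z ∈ slitDomain) :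
    ∃ d ≠ 0, HasStrictDerivAt schwarzTriangle d z := by
  obtain ⟨d, hd, h⟩ := hasDerivAt_schwarzTriangle hz
  have hdiff : DifferentiableOn ℂ schwarzTriangle slitDomain := fun y hy =>
    (hasDerivAt_schwarzTriangle hy).choose_spec.2.differentiableAt.differentiableWithinAt
  have h2 := (hdiff.analyticAt (isOpen_slitDomain.mem_nhds hz)).hasStrictDerivAt
  exact ⟨d, hd, h.deriv ▸ h2⟩

theorem continuousAt_schwarzTriangle {z : ℂ} (hz : z ∈ slitDomain) :
    ContinuousAt schwarzTriangle z :=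
  (hasDerivAt_schwarzTriangle hz).choose_spec.2.continuousAt

/-! ### The image lies in the quadrilateral -/

theorem schwarzTriangle_re_pos {z : ℂ} (hz : 0 < z.im) : 0 < (schwarzTriangle z).re := by
  have h1 := hypF_re_pos (z := z) (Or.inr hz.ne')
  have h2 := hypF_im_pos hz
  have hz' : (1 - z).im < 0 := by simpa using hz
  have h3 := hypF_re_pos (z := 1 - z) (Or.inr hz'.ne)
  have h4 := hypF_im_neg hz'
  have hn : 0 < normSq (hypF z) := normSq_pos.2 (hypF_ne_zero (Or.inr hz.ne'))
  rw [schwarzTriangle, mul_comm, mul_I_re, div_im, ← sub_div, neg_pos]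
  refine div_neg_of_neg_of_pos ?_ hn
  nlinarith [mul_pos h1 (neg_pos.2 h4), mul_pos h3 h2]

theorem schwarzTriangle_re_neg {z : ℂ} (hz : z.im < 0) : (schwarzTriangle z).re < 0 := by
  have h := schwarzTriangle_re_pos (z := 1 - z) (by simpa using hz)
  rw [schwarzTriangle_one_sub, neg_re, inv_re, ← neg_div] at h
  by_contra! h'
  exact absurd h (not_lt.2 (div_nonpos_of_nonpos_of_nonneg (by linarith) (normSq_nonneg _)))

theorem schwarzTriangle_ofReal {x : ℝ} (hx : x ∈ Ioo (0 : ℝ) 1) :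
    schwarzTriangle x = ((hypF (1 - x : ℝ)).re / (hypF x).re : ℝ) * I := by
  have h : ∀ {y : ℝ}, y < 1 → hypF y = ((hypF y).re : ℂ) := fun hy =>
    Complex.ext (by simp) (by simp [hypF_ofReal_im hy])
  rw [schwarzTriangle, mul_comm, show (1 - x : ℂ) = ((1 - x : ℝ) : ℂ) by push_cast; rfl, h hx.2,
    h (show 1 - x < 1 by linarith [hx.1])]
  simp

theorem schwarzTriangle_re_eq_zero {z : ℂ} (hz : z ∈ slitDomain) (him : z.im = 0) :
    (schwarzTriangle z).re = 0 := by
  rcases hz with ⟨x, hx, rfl⟩ | h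
  · rw [schwarzTriangle_ofReal hx, mul_I_re, ofReal_im, neg_zero]
  · exact absurd him h

theorem abs_schwarzTriangle_re_lt_one {z : ℂ} (hz : z ∈ slitDomain) :
    -1 < (schwarzTriangle z).re ∧ (schwarzTriangle z).re < 1 := by
  rcases lt_trichotomy z.im 0 with h | h | h
  · have e := schwarzTriangle_one_sub_inv_of_im_neg h
    have h1 := schwarzTriangle_re_pos (one_sub_one_sub_inv_mem_upperHalf h)
    have h2 := schwarzTriangle_re_neg h
    rw [e, add_re, one_re] at h1
    constructor <;> linarith
  · rw [schwarzTriangle_re_eq_zero hz h]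
    norm_num
  · have e := schwarzTriangle_one_sub_inv h
    have h1 := schwarzTriangle_re_pos h
    have h2 := schwarzTriangle_re_neg (z := 1 - (1 - z)⁻¹) 
      (by rw [sub_im, one_im, zero_sub, neg_lt_zero]; exact one_sub_inv_mem_upperHalf h)
    rw [e, sub_re, one_re] at h2
    constructor <;> linarith

theorem schwarzTriangle_ne_zero {z : ℂ} (hz : z ∈ slitDomain) : schwarzTriangle z ≠ 0 :=
  mul_ne_zero I_ne_zero (div_ne_zero
    (hypF_ne_zero (slitDomain_subset_cutPlane (one_sub_mem_slitDomain hz)))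
    (hypF_ne_zero (slitDomain_subset_cutPlane hz)))

theorem abs_schwarzTriangle_inv_re_lt_one {z : ℂ} (hz : z ∈ slitDomain) :
    -1 < (schwarzTriangle z)⁻¹.re ∧ (schwarzTriangle z)⁻¹.re < 1 := by
  have h := abs_schwarzTriangle_re_lt_one (one_sub_mem_slitDomain hz)
  rw [schwarzTriangle_one_sub, neg_re] at h
  constructor <;> linarith [h.1, h.2]

/-- A nonzero real number and its inverse cannot both have absolute value below `1`. -/
theorem schwarzTriangle_im_ne_zero {z : ℂ} (hz : z ∈ slitDomain) :
    (schwarzTriangle z).im ≠ 0 := by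
  intro h
  have h0 := schwarzTriangle_ne_zero hz
  obtain ⟨h1, h2⟩ := abs_schwarzTriangle_re_lt_one hz
  obtain ⟨h3, h4⟩ := abs_schwarzTriangle_inv_re_lt_one hz
  have e : schwarzTriangle z = ((schwarzTriangle z).re : ℂ) := Complex.ext (by simp) (by simp [h])
  rw [e, ← ofReal_inv, ofReal_re] at h3 h4
  have hr : (schwarzTriangle z).re ≠ 0 := fun h' => h0 (by rw [e, h', ofReal_zero])
  have := mul_inv_cancel₀ hr
  have h5 := abs_lt.2 ⟨h1, h2⟩
  have h6 := abs_lt.2 ⟨h3, h4⟩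
  have h7 := congrArg abs this
  rw [abs_mul, abs_one] at h7
  nlinarith [abs_nonneg (schwarzTriangle z).re, abs_nonneg (schwarzTriangle z).re⁻¹]

theorem schwarzTriangle_half : schwarzTriangle (1 / 2) = I := by
  rw [schwarzTriangle, show (1 : ℂ) - 1 / 2 = 1 / 2 by norm_num, div_self, mul_one]
  exact hypF_ne_zero (slitDomain_subset_cutPlane half_mem_slitDomain)

theorem schwarzTriangle_im_pos {z : ℂ} (hz : z ∈ slitDomain) : 0 < (schwarzTriangle z).im := by
  by_contra! h
  have hc : ContinuousOn (fun z => (schwarzTriangle z).im) slitDomain := fun y hy =>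
    (continuous_im.continuousAt.comp (continuousAt_schwarzTriangle hy)).continuousWithinAt
  obtain ⟨y, hy, hy'⟩ := isPreconnected_slitDomain.intermediate_value hz half_mem_slitDomain hc
    (show (0 : ℝ) ∈ Icc _ _ from ⟨h, by rw [schwarzTriangle_half, I_im]; norm_num⟩)
  exact schwarzTriangle_im_ne_zero hy hy'

/-- Each circle passes through `0`, and inversion turns it into a vertical line: `|2w - 1| > 1`
means `|w|² > Re w`. In this form the symmetry under `w ↦ -1/w` is visible. -/
theorem mem_fundamentalQuadrilateral_iff {w : ℂ} : w ∈ fundamentalQuadrilateral ↔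
    0 < w.im ∧ (-1 < w.re ∧ w.re < 1) ∧ (-1 < w⁻¹.re ∧ w⁻¹.re < 1) := by
  have key : 0 < w.im → ((1 < ‖2 * w - 1‖ ↔ w⁻¹.re < 1) ∧ (1 < ‖2 * w + 1‖ ↔ -1 < w⁻¹.re)) := by
    intro h
    have hn : 0 < normSq w := normSq_pos.2 (by rintro rfl; simp at h)
    have hsq : ∀ v : ℂ, 1 < ‖v‖ ↔ 1 < normSq v := fun v => by
      rw [normSq_eq_norm_sq, one_lt_sq_iff₀ (norm_nonneg v)]
    rw [hsq, hsq, inv_re, div_lt_one hn, lt_div_iff₀ hn]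
    simp only [normSq_apply, sub_re, add_re, sub_im, add_im, mul_re, mul_im, one_re, one_im, re_ofNat,
      im_ofNat]
    constructor <;> constructor <;> intro h <;> nlinarith
  constructor
  · rintro ⟨h1, h2, h3, h4, h5⟩
    exact ⟨h1, ⟨h2, h3⟩, (key h1).2.1 h5, (key h1).1.1 h4⟩
  · rintro ⟨h1, ⟨h2, h3⟩, h5, h4⟩
    exact ⟨h1, h2, h3, (key h1).1.2 h4, (key h1).2.2 h5⟩

theorem schwarzTriangle_mem {z : ℂ} (hz : z ∈ slitDomain) :
    schwarzTriangle z ∈ fundamentalQuadrilateral :=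
  mem_fundamentalQuadrilateral_iff.2 ⟨schwarzTriangle_im_pos hz, abs_schwarzTriangle_re_lt_one hz,
    abs_schwarzTriangle_inv_re_lt_one hz⟩

/-! ### Properness: behaviour at the boundary and at infinity -/

-- If `τ` converged, so would `F(1 - f) = -i τ(f) F(f)`, against its logarithmic blow-up.
open Filter Topology in
theorem not_tendsto_schwarzTriangle_of_tendsto_zero {α : Type*} {U : Filter α} [NeBot U]
    {f : α → ℂ} (hf : ∀ᶠ x in U, f x ∈ slitDomain) (h0 : Tendsto f U (𝓝 0)) (w : ℂ) :
    ¬ Tendsto (fun x => schwarzTriangle (f x)) U (𝓝 w) := by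
  intro hw
  have hF : Tendsto (fun x => hypF (f x)) U (𝓝 (hypF 0)) :=
    (hasDerivAt_hypF (Or.inl (by norm_num))).continuousAt.tendsto.comp h0
  have h1 := ((hw.mul hF).const_mul (-I))
  have h2 : Tendsto (fun x => hypF (1 - f x)) U (𝓝 (-I * (w * hypF 0))) := by
    refine h1.congr' ?_
    filter_upwards [hf] with x hx
    have := hypF_ne_zero (slitDomain_subset_cutPlane hx)
    rw [schwarzTriangle]
    field_simp
    linear_combination -hypF (1 - f x) * I_sq
  have h3 := (continuous_re.tendsto _).comp h2
  refine not_tendsto_nhds_of_tendsto_atTop ?_ _ h3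
  have hn : Tendsto (fun x => ‖f x‖) U (𝓝[>] 0) := by
    refine tendsto_nhdsWithin_iff.2 ⟨by simpa using h0.norm, ?_⟩
    filter_upwards [hf] with x hx
    refine norm_pos_iff.2 fun h => ?_
    rw [h, mem_slitDomain_iff] at hx
    simp at hx
  have hlog := ((tendsto_neg_atBot_atTop.comp (Real.tendsto_log_nhdsGT_zero.comp hn)).const_mul_atTop
    (show (0 : ℝ) < 1 / 2 by norm_num)).const_mul_atTop (show (0 : ℝ) < 1 / Real.pi by positivity)
  refine tendsto_atTop_mono' _ ?_ hlog
  filter_upwards [hf, (tendsto_nhds_of_tendsto_nhdsWithin hn).eventually (gt_mem_nhds one_pos)]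
    with x hx hx1
  have := log_le_hypF_re (slitDomain_subset_cutPlane (one_sub_mem_slitDomain hx))
    (by rwa [sub_sub_cancel])
  rwa [sub_sub_cancel] at this

theorem one_sub_inv_mem_slitDomain {z : ℂ} (hz : z.im ≠ 0) : (1 - z)⁻¹ ∈ slitDomain := by
  have h : 1 - z ≠ 0 := fun h => hz (by simp [← sub_eq_zero.1 h])
  rw [mem_slitDomain_iff]
  right
  simpa [inv_im] using ⟨hz, h⟩

open Filter Topology in
/-- Along an ultrafilter of non-real points, `τ` is asymptotic to a unit translate of
`z ↦ τ (z / (z - 1))`. -/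
theorem tendsto_schwarzTriangle_one_sub_inv {α : Type*} {U : Ultrafilter α} {f : α → ℂ}
    (hf : ∀ᶠ x in U, (f x).im ≠ 0) {w : ℂ}
    (hw : Tendsto (fun x => schwarzTriangle (f x)) U (𝓝 w)) :
    ∃ ε : ℝ, |ε| = 1 ∧
      Tendsto (fun x => schwarzTriangle (1 - (1 - f x)⁻¹)) U (𝓝 (w + ε)) := by
  rcases Ultrafilter.eventually_or.1 (hf.mono fun x hx => lt_or_gt_of_ne hx) with h | h
  · refine ⟨1, by simp, (hw.add_const _).congr' ?_⟩
    filter_upwards [h] with x hx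
    rw [schwarzTriangle_one_sub_inv_of_im_neg hx, ofReal_one]
  · refine ⟨-1, by simp, (hw.add_const _).congr' ?_⟩
    filter_upwards [h] with x hx
    rw [schwarzTriangle_one_sub_inv hx, ofReal_neg, ofReal_one, sub_eq_add_neg]

-- Near a negative `p` the points are non-real and `z/(z-1)` carries them to a point of `(0, 1)`,
-- where `Re τ = 0`. A limit of `τ` would thus have real part `±1`, which lies outside the open
-- quadrilateral.
open Filter Topology in
theorem not_tendsto_schwarzTriangle_of_nonpos {α : Type*} {U : Ultrafilter α} {f : α → ℂ}
    (hf : ∀ᶠ x in U, f x ∈ slitDomain) {p : ℝ} (hp : p ≤ 0) (h0 : Tendsto f U (𝓝 p)) {w : ℂ}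
    (hw : w ∈ fundamentalQuadrilateral) :
    ¬ Tendsto (fun x => schwarzTriangle (f x)) U (𝓝 w) := by
  intro h
  rcases hp.eq_or_lt with rfl | hp
  · exact not_tendsto_schwarzTriangle_of_tendsto_zero hf (by simpa using h0) w h
  have him : ∀ᶠ x in U, (f x).im ≠ 0 := by
    have hre := (continuous_re.tendsto _).comp h0
    filter_upwards [hf, hre.eventually (gt_mem_nhds (show (p : ℂ).re < 0 by simpa using hp))]
      with x hx hx'
    exact (mem_slitDomain_iff.1 hx).resolve_left fun h' => absurd h'.1 (not_lt.2 hx'.le)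
  obtain ⟨ε, hε, ht⟩ := tendsto_schwarzTriangle_one_sub_inv him h
  have h1p : (1 : ℝ) - p > 1 := by linarith
  have hp1 : (1 - (p : ℂ)) ≠ 0 := by
    rw [← ofReal_one, ← ofReal_sub]
    exact ofReal_ne_zero.2 (by linarith)
  have hq : 1 - (1 - p)⁻¹ ∈ Ioo (0 : ℝ) 1 :=
    ⟨sub_pos.2 (inv_lt_one_of_one_lt₀ h1p), sub_lt_self _ (by positivity)⟩
  have hlim : Tendsto (fun x => 1 - (1 - f x)⁻¹) U (𝓝 ((1 - (1 - p)⁻¹ : ℝ) : ℂ)) := by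
    push_cast
    exact ((h0.const_sub 1).inv₀ hp1).const_sub 1
  have hqS : ((1 - (1 - p)⁻¹ : ℝ) : ℂ) ∈ slitDomain := Or.inl ⟨_, hq, rfl⟩
  have e := tendsto_nhds_unique ht ((continuousAt_schwarzTriangle hqS).tendsto.comp hlim)
  have e2 := congrArg re e
  rw [schwarzTriangle_re_eq_zero hqS (ofReal_im _), add_re, ofReal_re] at e2
  have : |w.re| < 1 := abs_lt.2 ⟨hw.2.1, hw.2.2.1⟩
  rw [show w.re = -ε by linarith, abs_neg, hε] at this
  exact this.false

theorem neg_inv_mem_fundamentalQuadrilateral {w : ℂ} (hw : w ∈ fundamentalQuadrilateral) :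
    -w⁻¹ ∈ fundamentalQuadrilateral := by
  rw [mem_fundamentalQuadrilateral_iff] at *
  obtain ⟨h1, ⟨h2, h3⟩, h4, h5⟩ := hw
  have hn : 0 < normSq w := normSq_pos.2 (by rintro rfl; simp at h1)
  refine ⟨?_, ?_, ?_⟩
  · rw [neg_im, inv_im, ← neg_div, neg_neg]
    positivity
  · rw [neg_re]
    constructor <;> linarith
  · rw [← inv_neg, inv_inv, neg_re]
    constructor <;> linarith

open Filter Topology in
/-- `τ` is a proper map into the quadrilateral. -/
theorem exists_tendsto_of_tendsto_schwarzTriangle {α : Type*} {U : Ultrafilter α} {f : α → ℂ}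
    (hf : ∀ᶠ x in U, f x ∈ slitDomain) {w : ℂ} (hw : w ∈ fundamentalQuadrilateral)
    (h : Tendsto (fun x => schwarzTriangle (f x)) U (𝓝 w)) :
    ∃ p ∈ slitDomain, Tendsto f U (𝓝 p) ∧ schwarzTriangle p = w := by
  have hw0 : w ≠ 0 := by
    rintro rfl
    simpa using hw.1
  by_cases hcc : Tendsto f U (cocompact ℂ)
  · exfalso
    have him : ∀ᶠ x in U, (f x).im ≠ 0 := by
      filter_upwards [hf, (tendsto_norm_cocompact_atTop.comp hcc).eventually_gt_atTop 1]
        with x hx hx'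
      refine (mem_slitDomain_iff.1 hx).elim (fun h1 h2 => ?_) id
      have e : f x = ((f x).re : ℂ) := Complex.ext (by simp) (by simp [h2])
      rw [Function.comp_apply, e, norm_real, Real.norm_of_nonneg h1.1.le] at hx'
      linarith [h1.2]
    obtain ⟨ε, -, ht⟩ := tendsto_schwarzTriangle_one_sub_inv him h
    have hwε : w + ε ≠ 0 := fun h' => by
      have := congrArg im h'
      rw [add_im, ofReal_im, add_zero, zero_im] at this
      exact hw.1.ne' this
    have hlim : Tendsto (fun x => (1 - f x)⁻¹) U (𝓝 0) := by
      have h1 : Tendsto (fun x => 1 - f x) U (cocompact ℂ) := by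
        have := (Homeomorph.subLeft (1 : ℂ)).isClosedEmbedding.tendsto_cocompact.comp hcc
        exact this
      exact (tendsto_inv₀_cobounded (α := ℂ)).comp (by
        rwa [← Metric.cobounded_eq_cocompact] at h1)
    -- The escape to infinity is moved to `0` by `z ↦ 1/(1-z)`, under which `τ` would tend to `-1/(w
    -- + ε)`; this is finite since `Im w > 0`.
    refine not_tendsto_schwarzTriangle_of_tendsto_zero
      (him.mono fun x hx => one_sub_inv_mem_slitDomain hx) hlim (-(w + ε)⁻¹) ?_
    refine (ht.inv₀ hwε).neg.congr fun x => ?_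
    rw [schwarzTriangle_one_sub, inv_neg, neg_neg, inv_inv]
  -- An ultrafilter that does not escape to infinity contains a compact set, hence converges.
  · have hex : ∃ p, Tendsto f U (𝓝 p) := by
      rw [tendsto_def] at hcc
      push Not at hcc
      obtain ⟨s, hs, hs'⟩ := hcc
      obtain ⟨K, hK, hKs⟩ := mem_cocompact.1 hs
      have hKU : K ∈ U.map f := by
        rw [← Ultrafilter.compl_notMem_iff]
        exact fun hc => hs' (mem_of_superset hc (preimage_mono hKs))
      obtain ⟨p, -, hp⟩ := hK.ultrafilter_le_nhds' (U.map f) hKU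
      exact ⟨p, hp⟩
    obtain ⟨p, hp⟩ := hex
    by_cases hpS : p ∈ slitDomain
    · exact ⟨p, hpS, hp,
        tendsto_nhds_unique ((continuousAt_schwarzTriangle hpS).tendsto.comp hp) h⟩
    exfalso
    rw [mem_slitDomain_iff] at hpS
    push Not at hpS
    obtain ⟨hp1, hp2⟩ := hpS
    have e : p = (p.re : ℂ) := Complex.ext (by simp) (by simp [hp2])
    rcases le_or_gt p.re 0 with h0 | h0
    · exact not_tendsto_schwarzTriangle_of_nonpos hf h0 (e ▸ hp) hw h
    · have h1 := hp1 h0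
      refine not_tendsto_schwarzTriangle_of_nonpos (f := fun x => 1 - f x) (p := 1 - p.re)
        (hf.mono fun x hx => one_sub_mem_slitDomain hx) (by linarith)
        (by push_cast; rw [← e]; exact hp.const_sub 1)
        (neg_inv_mem_fundamentalQuadrilateral hw) ?_
      exact (h.inv₀ hw0).neg.congr fun x => (schwarzTriangle_one_sub _).symm

/-! ### Surjectivity and injectivity -/

/-- The vertical ray above any point stays in the quadrilateral and meets the convex half-strip `Im
> 1`, which is contained in it. -/
theorem isPreconnected_fundamentalQuadrilateral : IsPreconnected fundamentalQuadrilateral := by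
  have hR : IsPreconnected ({w : ℂ | 1 < w.im} ∩ ({w | -1 < w.re} ∩ {w | w.re < 1})) :=
    ((convex_halfSpace_im_gt 1).inter
      ((convex_halfSpace_re_gt (-1)).inter (convex_halfSpace_re_lt 1))).isPreconnected
  have hsq : ∀ v : ℂ, 1 < ‖v‖ ↔ 1 < normSq v := fun v => by
    rw [normSq_eq_norm_sq, one_lt_sq_iff₀ (norm_nonneg v)]
  have hmem : ∀ {w v : ℂ}, -1 < w.re → w.re < 1 → 0 < v.im → v.im ≤ w.im → v.re = w.re →
      1 < ‖2 * v - 1‖ → 1 < ‖2 * v + 1‖ → w ∈ fundamentalQuadrilateral := by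
    intro w v h1 h2 h3 h4 h5 h6 h7
    refine ⟨h3.trans_le h4, h1, h2, ?_, ?_⟩
    · rw [hsq] at h6 ⊢
      simp only [normSq_apply, sub_re, sub_im, mul_re, mul_im, one_re, one_im,
        re_ofNat, im_ofNat] at h6 ⊢
      rw [h5] at h6
      nlinarith
    · rw [hsq] at h7 ⊢
      simp only [normSq_apply, add_re, add_im, mul_re, mul_im, one_re, one_im,
        re_ofNat, im_ofNat] at h7 ⊢
      rw [h5] at h7
      nlinarith
  have hRQ : {w : ℂ | 1 < w.im} ∩ ({w | -1 < w.re} ∩ {w | w.re < 1}) ⊆ fundamentalQuadrilateral := by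
    rintro w ⟨h1, h2, h3⟩
    have h1' : 1 < w.im := h1
    refine ⟨by linarith, h2, h3, ?_, ?_⟩
    · rw [hsq]
      simp only [normSq_apply, sub_re, sub_im, mul_re, mul_im, one_re, one_im, re_ofNat, im_ofNat]
      nlinarith
    · rw [hsq]
      simp only [normSq_apply, add_re, add_im, mul_re, mul_im, one_re, one_im, re_ofNat, im_ofNat]
      nlinarith
  refine isPreconnected_of_forall (2 * I) fun w hw => ?_
  have hV : IsPreconnected ({v : ℂ | w.im ≤ v.im} ∩ {v | v.re = w.re}) :=
    ((convex_halfSpace_im_ge w.im).inter (convex_hyperplane (r := w.re) reLm.isLinear)).isPreconnected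
  refine ⟨_, union_subset hRQ (t := {v : ℂ | w.im ≤ v.im} ∩ {v | v.re = w.re}) ?_,
    Or.inl ⟨by simp, by simp, by simp⟩, Or.inr ⟨le_refl w.im, rfl⟩,
    hR.union (⟨w.re, w.im + 1⟩ : ℂ) ⟨?_, hw.2.1, hw.2.2.1⟩ ⟨?_, rfl⟩ hV⟩
  · rintro v ⟨h1, h2⟩
    have h2' : v.re = w.re := h2
    exact hmem (h2'.symm ▸ hw.2.1) (h2'.symm ▸ hw.2.2.1) hw.1 h1 h2'.symm hw.2.2.2.1 hw.2.2.2.2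
  · have := hw.1
    show 1 < w.im + 1
    linarith
  · show w.im ≤ w.im + 1
    linarith

/-- Off the real axis `Re τ ≠ 0`; on `(0, 1)` the equation reads `F(1 - x) = F(x)`, and `F` is
strictly increasing there. -/
theorem eq_half_of_schwarzTriangle_eq_I {z : ℂ} (hz : z ∈ slitDomain)
    (h : schwarzTriangle z = I) : z = 1 / 2 := by
  rcases hz with ⟨x, hx, rfl⟩ | him
  · rw [schwarzTriangle_ofReal hx] at h
    have h1 := congrArg im h
    rw [mul_I_im, ofReal_re, I_im, div_eq_one_iff_eq (hypF_re_pos (Or.inl hx.2)).ne'] at h1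
    rcases lt_trichotomy x (1 - x) with h2 | h2 | h2
    · exact absurd h1 (hypF_ofReal_re_lt h2 (by linarith [hx.1])).ne'
    · have : x = 1 / 2 := by linarith
      rw [this]; push_cast; rfl
    · exact absurd h1 (hypF_ofReal_re_lt h2 hx.2).ne
  · exfalso
    have h1 : (schwarzTriangle z).re = 0 := by rw [h, I_re]
    rcases lt_or_gt_of_ne him with h2 | h2
    · exact (schwarzTriangle_re_neg h2).ne h1
    · exact (schwarzTriangle_re_pos h2).ne' h1

theorem image_mem_nhds {z : ℂ} (hz : z ∈ slitDomain) {V : Set ℂ} (hV : V ∈ nhds z) :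
    schwarzTriangle '' V ∈ nhds (schwarzTriangle z) := by
  obtain ⟨d, hd, h⟩ := hasStrictDerivAt_schwarzTriangle hz
  rw [← h.map_nhds_eq hd]
  exact Filter.image_mem_map hV

open Filter Topology in
theorem image_schwarzTriangle : schwarzTriangle '' slitDomain = fundamentalQuadrilateral := by
  refine Subset.antisymm (image_subset_iff.2 fun z hz => schwarzTriangle_mem hz) ?_
  refine isPreconnected_fundamentalQuadrilateral.subset_of_closure_inter_subset ?_
    ⟨_, schwarzTriangle_mem half_mem_slitDomain, mem_image_of_mem _ half_mem_slitDomain⟩ ?_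
  · rw [isOpen_iff_mem_nhds]
    rintro _ ⟨z, hz, rfl⟩
    exact image_mem_nhds hz (isOpen_slitDomain.mem_nhds hz)
  · rintro w ⟨hw, hwQ⟩
    obtain ⟨V, hV, hVw⟩ := mem_closure_iff_ultrafilter.1 hw
    classical
    obtain ⟨p, hp, -, h⟩ := exists_tendsto_of_tendsto_schwarzTriangle (U := V)
      -- A choice of preimages; the value `0` off the image is irrelevant, since the ultrafilter
      -- contains the image.
      (f := fun y => if hy : y ∈ schwarzTriangle '' slitDomain then hy.choose else 0)
      (by
        filter_upwards [hV] with y hy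
        rw [dif_pos hy]
        exact hy.choose_spec.1) hwQ
      (by
        refine Tendsto.congr' ?_ hVw
        filter_upwards [hV] with y hy
        rw [dif_pos hy, hy.choose_spec.2])
    exact ⟨p, hp, h⟩

open Filter Topology in
theorem injOn_schwarzTriangle : InjOn schwarzTriangle slitDomain := by
  -- The values attained at least twice.
  set A : Set ℂ := {w | ∃ q : ℂ × ℂ, (q.1 ∈ slitDomain ∧ q.2 ∈ slitDomain ∧ q.1 ≠ q.2) ∧
    schwarzTriangle q.1 = w ∧ schwarzTriangle q.2 = w} with hA
  have hopen : IsOpen A := by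
    rw [isOpen_iff_mem_nhds]
    rintro w ⟨⟨a, b⟩, ⟨ha, hb, hab⟩, rfl, hbw⟩
    obtain ⟨u, v, hu, hv, hau, hbv, huv⟩ := t2_separation hab
    have h1 := image_mem_nhds ha (inter_mem (isOpen_slitDomain.mem_nhds ha) (hu.mem_nhds hau))
    have h2 := image_mem_nhds hb (inter_mem (isOpen_slitDomain.mem_nhds hb) (hv.mem_nhds hbv))
    rw [show schwarzTriangle b = schwarzTriangle a from hbw] at h2
    filter_upwards [h1, h2]
    rintro y ⟨a', ⟨ha', hau'⟩, rfl⟩ ⟨b', ⟨hb', hbv'⟩, hy⟩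
    exact ⟨(a', b'), ⟨ha', hb', fun e : a' = b' => disjoint_left.1 huv hau' (e ▸ hbv')⟩, rfl, hy⟩
  have hclosed : closure A ∩ fundamentalQuadrilateral ⊆ A := by
    rintro w ⟨hw, hwQ⟩
    obtain ⟨V, hV, hVw⟩ := mem_closure_iff_ultrafilter.1 hw
    classical
    let f : ℂ → ℂ × ℂ := fun y => if hy : y ∈ A then hy.choose else 0
    have hf : ∀ y ∈ A, ((f y).1 ∈ slitDomain ∧ (f y).2 ∈ slitDomain ∧ (f y).1 ≠ (f y).2) ∧
        schwarzTriangle (f y).1 = y ∧ schwarzTriangle (f y).2 = y := by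
      intro y hy
      simp only [f, dif_pos hy]
      exact hy.choose_spec
    have hfV : ∀ᶠ y in V, ((f y).1 ∈ slitDomain ∧ (f y).2 ∈ slitDomain ∧ (f y).1 ≠ (f y).2) ∧
        schwarzTriangle (f y).1 = y ∧ schwarzTriangle (f y).2 = y := by
      filter_upwards [hV] with y hy using hf y hy
    obtain ⟨p, hp, hpt, hpw⟩ := exists_tendsto_of_tendsto_schwarzTriangle (U := V)
      (f := fun y => (f y).1) (hfV.mono fun y hy => hy.1.1) hwQ
      (Tendsto.congr' (hfV.mono fun y hy => hy.2.1.symm) hVw)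
    obtain ⟨q, hq, hqt, hqw⟩ := exists_tendsto_of_tendsto_schwarzTriangle (U := V)
      (f := fun y => (f y).2) (hfV.mono fun y hy => hy.1.2.1) hwQ
      (Tendsto.congr' (hfV.mono fun y hy => hy.2.2.symm) hVw)
    refine ⟨(p, q), ⟨hp, hq, fun e => ?_⟩, hpw, hqw⟩
    have e' : p = q := e
    subst e'
    -- If both families of preimages converged to the same `p`, a local left inverse at `p` would
    -- identify preimages that are distinct.
    obtain ⟨d, hd, hder⟩ := hasStrictDerivAt_schwarzTriangle hp
    have hinv := hder.eventually_left_inverse hd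
    obtain ⟨y, ⟨⟨-, -, hne⟩, h1, h2⟩, h3, h4⟩ :=
      (hfV.and ((hpt.eventually hinv).and (hqt.eventually hinv))).exists
    rw [h1] at h3
    rw [h2] at h4
    exact hne (h3.symm.trans h4)
  intro a ha b hb hab
  by_contra hne
  have hQ := isPreconnected_fundamentalQuadrilateral.subset_of_closure_inter_subset hopen
    ⟨_, schwarzTriangle_mem ha, (a, b), ⟨ha, hb, hne⟩, rfl, hab.symm⟩ hclosed
  obtain ⟨⟨x, y⟩, ⟨hx, hy, hxy⟩, h1, h2⟩ := hQ (schwarzTriangle_mem half_mem_slitDomain)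
  rw [schwarzTriangle_half] at h1 h2
  exact hxy ((eq_half_of_schwarzTriangle_eq_I hx h1).trans
    (eq_half_of_schwarzTriangle_eq_I hy h2).symm)

theorem mainTheorem6 :
    schwarzTriangle '' slitDomain = fundamentalQuadrilateral ∧
      Set.InjOn schwarzTriangle slitDomain :=
  ⟨image_schwarzTriangle, injOn_schwarzTriangle⟩
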